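/- Let $\mathbb C$ be a finitely complete category and $\pi\colon \tilde U\to U$ a universal map, i.e. an exponentiable map (with chosen pushforward $\pi_*$) together with a choice of pullbacks of $\pi$. A \emph{fibrancy structure} on a map $E\to B$ is a pair of maps $B\to U$, $E\to\tilde U$ exhibiting it as a pullback of $\pi$; maps admitting one are $\pi$-fibrations, and fibrancy structures are pulled back by composition. An object $E\to B$ of $\mathbb C/B$ is $\pi$-fibrant if it is a $\pi$-fibration. Pushforward $q_*$ along a $\pi$-fibration $q$ exists. For $s\colon Y\to E$ in $\mathbb C/B$ let $(s\boxslash_B (B\times\pi))$ be the set of lifting structures: choices, for each $X\to B$ and each $u\colon X\times_B Y\to\tilde U$, $v\colon X\times_B E\to U$ with $\pi u=v\,(X\times_B s)$, of a map $\ell\colon X\times_B E\to\tilde U$ with $\ell\,(X\times_B s)=u$ and $\pi\ell=v$, natural in $X$. These reindex along maps $B'\to B$. Let $P_\pi(Z)=\pi_*(\tilde U\times Z)$. Suppose $\pi$ has a $\Pi$-type structure (a fibrancy structure on $P_\pi(\pi)\colon P_\pi(\tilde U)\to P_\pi(U)$) and an $\mathrm{Id}$-type structure: maps $\mathrm{Id}\colon\tilde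 U\times_U\tilde U\to U$ and $\lceil\mathrm{refl}\rceil\colon\tilde U\to\tilde U$ with $\pi\lceil\mathrm{refl}\rceil=\mathrm{Id}\circ\Delta$, and, for the induced map $\mathrm{refl}\colon \tilde U\to \mathrm{Id}_U(\tilde U)$ over $U$ into the chosen pullback of $\pi$ along $\mathrm{Id}$, an element $\mathsf J\in(\mathrm{refl}\boxslash_U (U\times\pi))$. A \emph{pointed functional extensionality structure} is an element of $(P_\pi(\mathrm{refl})\boxslash_U (U\times\pi))$. A \emph{stable pushforward family} consists of maps $$\mathrm{ptdfunext}_{q,s}\colon (s\boxslash_B (B\times\pi))\to (q_*s\boxslash_A (A\times\pi))$$ for all $q\colon B\to A$ and all $s\colon Y\to E$ in $\mathbb C/B$, where $q$, $Y\to B$ and $E\to B$ are equipped with fibrancy structures, such that for each $f\colon A'\to A$, and all pullbacks of $q$, $Y$, $E$, $s$ along $f$ with the induced fibrancy structures, $\mathrm{ptdfunext}_{f^*q,f^*s}(f^*F)=f^*(\mathrm{ptdfunext}_{q,s}(F))$, under the Beck–Chevalley identification $(f^*q)_*f^*s\cong f^*q_*s$. Then: (1) If $\pi$ has a pointed functional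 extensionality structure, then there is a stable pushforward family. (2) Conversely, suppose $\mathrm{Id}_U(\tilde U)\to U$ is equipped with a fibrancy structure (this is possible for instance if $\pi$-fibrations are closed under composition, as they are when $\pi$ has a $\Sigma$-type structure). Then each stable pushforward family restricts to a pointed functional extensionality structure. Namely, let $q\colon\pi^*P_\pi(U)\to P_\pi(U)$ be the generic $\pi$-fibration, $\mathrm{ev}\colon\pi^*P_\pi(U)\to U$ the evaluation and $s=\mathrm{ev}^*(\mathrm{refl})$, so that $q_*s\cong P_\pi(\mathrm{refl})$ over $P_\pi(U)$. Then there is a pointed functional extensionality structure whose lifts of $X\times_U P_\pi(\mathrm{refl})\cong (X\times_U P_\pi(U))\times_{P_\pi(U)}q_*s$, for $X\to U$, are those given by $\mathrm{ptdfunext}_{q,s}(\mathrm{ev}^*\mathsf J)$. (3) In particular, if $\pi$ has a pointed functional extensionality structure, $q\colon B\to A$ is a $\pi$-fibration and $s$ is a map between $\pi$-fibrant objects over $B$ with $(s\boxslash_B (B\times\pi))\ne\emptyset$, then $(q_*s\boxslash_A (A\times\pi))\neq\emptyset$. -/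

import Mathlib

open CategoryTheory CategoryTheory.Limits

noncomputable section

namespace UniverseCategory

universe v u

variable {C : Type u} [Category.{v} C] [HasFiniteLimits C]

/-! ### Fibrations and pushforwards

A universal map is a map `π : Ut ⟶ U` with `[ChosenPullbacksAlong π]` (the universe structure: a
choice of right adjoint of `Over.map π`, i.e. selected pullbacks of `π`) and
`[ExponentiableMorphism π]` (a right adjoint of the pullback functor along `π`). -/

/-- A `π`-fibrancy structure on `p : E ⟶ B`: a name `B ⟶ U` and a point `E ⟶ Ut` exhibiting `p` as
a pullback of `π`. -/
structure FibrancyStructure {Ut U : C} (π : Ut ⟶ U) {E B : C} (p : E ⟶ B) where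
  name : B ⟶ U
  point : E ⟶ Ut
  isPullback : IsPullback point p π name

/-- A `π`-fibration is a map which can be equipped with a `π`-fibrancy structure. -/
def IsFibration {Ut U : C} (π : Ut ⟶ U) {E B : C} (p : E ⟶ B) : Prop :=
  Nonempty (FibrancyStructure π p)

theorem FibrancyStructure.isFibration {Ut U : C} {π : Ut ⟶ U} {E B : C} {p : E ⟶ B}
    (h : FibrancyStructure π p) : IsFibration π p := ⟨h⟩

/-- The fibrancy structure of `π` itself. -/
def FibrancyStructure.self {Ut U : C} (π : Ut ⟶ U) : FibrancyStructure π π where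
  name := 𝟙 U
  point := 𝟙 Ut
  isPullback := IsPullback.of_horiz_isIso ⟨by simp⟩

/-- The pullback of a fibrancy structure along a pullback square. -/
@[simps]
def FibrancyStructure.pullback {Ut U : C} {π : Ut ⟶ U} {E B E' B' : C} {p : E ⟶ B}
    (h : FibrancyStructure π p) {c : E' ⟶ E} {p' : E' ⟶ B'} {f : B' ⟶ B}
    (sq : IsPullback c p' p f) : FibrancyStructure π p' where
  name := f ≫ h.name
  point := c ≫ h.point
  isPullback := by
    have := (sq.flip.paste_vert h.isPullback.flip).flip
    exact this

/-- A pullback of an exponentiable map is exponentiable. -/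
theorem isLeftAdjoint_of_isPullback {Ut U A B : C} {π : Ut ⟶ U} {t : B ⟶ Ut} {q : B ⟶ A}
    {n : A ⟶ U} (sq : IsPullback t q π n) (h : (Over.pullback π).IsLeftAdjoint) :
    (Over.pullback q).IsLeftAdjoint := by
  let e : ((Over.pullback π).obj (Over.mk n)).left ≅ B :=
    (IsPullback.of_hasPullback n π).isoIsPullback _ _ sq.flip
  let F := (Over.mk n).iteratedSliceEquiv.inverse ⋙ Over.post (Over.pullback π) ⋙
    ((Over.pullback π).obj (Over.mk n)).iteratedSliceEquiv.functor ⋙ Over.map e.hom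
  have hF : F.IsLeftAdjoint := inferInstance
  have he1 : e.hom ≫ t = pullback.snd n π := IsPullback.isoIsPullback_hom_snd _ _ _ _
  have he2 : e.hom ≫ q = pullback.fst n π := IsPullback.isoIsPullback_hom_fst _ _ _ _
  let Z (T : Over A) : IsPullback (pullback.fst T.hom q) (pullback.snd T.hom q ≫ t)
      (T.hom ≫ n) π := (IsPullback.of_hasPullback T.hom q).paste_vert sq.flip
  let α (T : Over A) := (IsPullback.of_hasPullback (T.hom ≫ n) π).isoIsPullback _ _ (Z T)
  have α1 (T : Over A) : (α T).hom ≫ pullback.fst T.hom q = pullback.fst (T.hom ≫ n) π :=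
    IsPullback.isoIsPullback_hom_fst _ _ _ _
  have α2 (T : Over A) : (α T).hom ≫ pullback.snd T.hom q ≫ t = pullback.snd (T.hom ≫ n) π :=
    IsPullback.isoIsPullback_hom_snd _ _ _ _
  have w (T : Over A) (h) : (α T).hom ≫ pullback.snd T.hom q =
      pullback.lift (f := n) (g := π) (pullback.fst (T.hom ≫ n) π ≫ T.hom)
        (pullback.snd (T.hom ≫ n) π) h ≫ e.hom := by
    apply sq.hom_ext
    · rw [Category.assoc, Category.assoc, α2, he1, pullback.lift_snd]
    · rw [Category.assoc, Category.assoc, he2, pullback.lift_fst, ← pullback.condition, ← α1,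
        Category.assoc]
  have i : F ≅ Over.pullback q := NatIso.ofComponents
    (fun T => Over.isoMk (α T) (w T _))
    (by
      intro S T k
      ext
      refine (Z T).hom_ext ?_ ?_
      · refine (Category.assoc _ _ _).trans ?_
        refine (congrArg _ (α1 T)).trans ?_
        refine (pullback.lift_fst _ _ _).trans ?_
        refine Eq.trans ?_ (Category.assoc _ _ _).symm
        refine Eq.trans ?_ (congrArg ((α S).hom ≫ ·) (pullback.lift_fst _ _ _).symm)
        exact ((α1 S).symm ▸ rfl : pullback.fst (S.hom ≫ n) π ≫ k.left =
          ((α S).hom ≫ pullback.fst S.hom q) ≫ k.left).trans (Category.assoc _ _ _)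
      · refine (Category.assoc _ _ _).trans ?_
        refine (congrArg _ (α2 T)).trans ?_
        refine (pullback.lift_snd _ _ _).trans ?_
        refine ((α2 S).symm.trans ?_).trans (Category.assoc _ _ _).symm
        refine congrArg ((α S).hom ≫ ·) ?_
        refine Eq.trans ?_ (Category.assoc _ _ _)
        exact congrArg (· ≫ t) (pullback.lift_snd _ _ _).symm)
  exact Functor.isLeftAdjoint_of_iso i

theorem IsFibration.isLeftAdjoint {Ut U : C} {π : Ut ⟶ U} [ChosenPullbacksAlong π]
    [ExponentiableMorphism π] {B A : C} {q : B ⟶ A} (hq : IsFibration π q) :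
    (Over.pullback q).IsLeftAdjoint := by
  obtain ⟨h⟩ := hq
  have h0 : (ChosenPullbacksAlong.pullback π).IsLeftAdjoint :=
    (ExponentiableMorphism.pullbackPushforwardAdj π).isLeftAdjoint
  have h1 : (Over.pullback π).IsLeftAdjoint := Functor.isLeftAdjoint_of_iso
    ((ChosenPullbacksAlong.mapPullbackAdj π).rightAdjointUniq (Over.mapPullbackAdj π))
  exact isLeftAdjoint_of_isPullback h.isPullback h1

/-- The pushforward `q_*` along a `π`-fibration `q`: the right adjoint of `q^*`. -/
def pushforward {Ut U : C} {π : Ut ⟶ U} [ChosenPullbacksAlong π] [ExponentiableMorphism π]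
    {B A : C} (q : B ⟶ A) (hq : IsFibration π q) : Over B ⥤ Over A :=
  haveI := hq.isLeftAdjoint
  (Over.pullback q).rightAdjoint

/-- The adjunction `q^* ⊣ q_*`. -/
def pushforwardAdj {Ut U : C} {π : Ut ⟶ U} [ChosenPullbacksAlong π] [ExponentiableMorphism π]
    {B A : C} (q : B ⟶ A) (hq : IsFibration π q) : Over.pullback q ⊣ pushforward q hq :=
  haveI := hq.isLeftAdjoint
  Adjunction.ofIsLeftAdjoint (Over.pullback q)

/-! ### Lifting structures -/

/-- `X ×_B s : X ×_B Y ⟶ X ×_B E`. -/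
def baseMap {B : C} (X : Over B) {Y E : Over B} (s : Y ⟶ E) :
    pullback X.hom Y.hom ⟶ pullback X.hom E.hom :=
  pullback.lift (pullback.fst _ _) (pullback.snd _ _ ≫ s.left)
    (by rw [Category.assoc, Over.w, pullback.condition])

/-- `t ×_B Y : X' ×_B Y ⟶ X ×_B Y`. -/
def testMap {B : C} {X' X : Over B} (t : X' ⟶ X) (Y : Over B) :
    pullback X'.hom Y.hom ⟶ pullback X.hom Y.hom :=
  pullback.lift (pullback.fst _ _ ≫ t.left) (pullback.snd _ _)
    (by rw [Category.assoc, Over.w, pullback.condition])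

@[simp]
theorem baseMap_fst {B : C} (X : Over B) {Y E : Over B} (s : Y ⟶ E) :
    baseMap X s ≫ pullback.fst X.hom E.hom = pullback.fst X.hom Y.hom :=
  pullback.lift_fst _ _ _

@[simp]
theorem baseMap_snd {B : C} (X : Over B) {Y E : Over B} (s : Y ⟶ E) :
    baseMap X s ≫ pullback.snd X.hom E.hom = pullback.snd X.hom Y.hom ≫ s.left :=
  pullback.lift_snd _ _ _

@[simp]
theorem testMap_fst {B : C} {X' X : Over B} (t : X' ⟶ X) (Y : Over B) :
    testMap t Y ≫ pullback.fst X.hom Y.hom = pullback.fst X'.hom Y.hom ≫ t.left :=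
  pullback.lift_fst _ _ _

@[simp]
theorem testMap_snd {B : C} {X' X : Over B} (t : X' ⟶ X) (Y : Over B) :
    testMap t Y ≫ pullback.snd X.hom Y.hom = pullback.snd X'.hom Y.hom :=
  pullback.lift_snd _ _ _

theorem testMap_baseMap {B : C} {X' X : Over B} (t : X' ⟶ X) {Y E : Over B} (s : Y ⟶ E) :
    testMap t Y ≫ baseMap X s = baseMap X' s ≫ testMap t E := by
  apply pullback.hom_ext
  · simp only [Category.assoc, baseMap_fst, testMap_fst, reassoc_of% @baseMap_fst]
  · simp only [Category.assoc, baseMap_snd, testMap_snd, reassoc_of% @testMap_snd]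

/-- The set `s ⧄_B (B × π)` of lifting structures, in the slice over `B`, of `s : Y ⟶ E` against
`B × π : B × Ut ⟶ B × U`: a choice, for each `X` over `B`, of a solution of every lifting problem
of `X ×_B s` against `B × π` over `B`, uniform in `X`. A map over `B` into `B × Ut` or `B × U` is
the same thing as a map into `Ut` or `U`. -/
@[ext]
structure LiftingStructure {Ut U : C} (π : Ut ⟶ U) {B : C} {Y E : Over B} (s : Y ⟶ E) where
  lift (X : Over B) (u : pullback X.hom Y.hom ⟶ Ut) (v : pullback X.hom E.hom ⟶ U)
    (w : u ≫ π = baseMap X s ≫ v) : pullback X.hom E.hom ⟶ Ut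
  upper (X : Over B) (u : pullback X.hom Y.hom ⟶ Ut) (v : pullback X.hom E.hom ⟶ U)
    (w : u ≫ π = baseMap X s ≫ v) : baseMap X s ≫ lift X u v w = u
  lower (X : Over B) (u : pullback X.hom Y.hom ⟶ Ut) (v : pullback X.hom E.hom ⟶ U)
    (w : u ≫ π = baseMap X s ≫ v) : lift X u v w ≫ π = v
  uniform {X' X : Over B} (t : X' ⟶ X) (u : pullback X.hom Y.hom ⟶ Ut)
    (v : pullback X.hom E.hom ⟶ U) (w : u ≫ π = baseMap X s ≫ v) :
    lift X' (testMap t Y ≫ u) (testMap t E ≫ v)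
      (by rw [Category.assoc, w, ← Category.assoc, testMap_baseMap, Category.assoc]) =
      testMap t E ≫ lift X u v w

section Paste

variable {B B' : C} {g : B' ⟶ B} {Y : Over B} {Y' : Over B'} {c : Y'.left ⟶ Y.left}
  (hc : IsPullback c Y'.hom Y.hom g) (X : Over B')

/-- For `Y'` the pullback of `Y` along `g : B' ⟶ B` and `X` over `B'`, the canonical map
`X ×_{B'} Y' ⟶ X ×_B Y`. -/
def pasteHom : pullback X.hom Y'.hom ⟶ pullback ((Over.map g).obj X).hom Y.hom :=
  pullback.lift (pullback.fst _ _) (pullback.snd _ _ ≫ c) (by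
    rw [Category.assoc, hc.w, ← pullback.condition_assoc]; rfl)

/-- The inverse of `pasteHom`. -/
def pasteInv : pullback ((Over.map g).obj X).hom Y.hom ⟶ pullback X.hom Y'.hom :=
  pullback.lift (pullback.fst _ _)
    (hc.lift (pullback.snd _ _) (pullback.fst _ _ ≫ X.hom) (by
      rw [Category.assoc]; exact pullback.condition.symm))
    (by exact (hc.lift_snd _ _ _).symm)

@[simp]
theorem pasteHom_fst : pasteHom hc X ≫ pullback.fst ((Over.map g).obj X).hom Y.hom =
    pullback.fst X.hom Y'.hom := pullback.lift_fst _ _ _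

@[simp]
theorem pasteHom_snd : pasteHom hc X ≫ pullback.snd ((Over.map g).obj X).hom Y.hom =
    pullback.snd X.hom Y'.hom ≫ c := pullback.lift_snd _ _ _

@[simp]
theorem pasteInv_fst : pasteInv hc X ≫ pullback.fst X.hom Y'.hom =
    pullback.fst ((Over.map g).obj X).hom Y.hom := pullback.lift_fst _ _ _

@[simp]
theorem pasteInv_snd : pasteInv hc X ≫ pullback.snd X.hom Y'.hom ≫ c =
    pullback.snd ((Over.map g).obj X).hom Y.hom := by
  rw [← Category.assoc, show pasteInv hc X ≫ pullback.snd X.hom Y'.hom = _ from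
    pullback.lift_snd _ _ _]
  exact hc.lift_fst _ _ _

theorem paste_ext (hc : IsPullback c Y'.hom Y.hom g) (X : Over B') {W : C} {a b : W ⟶ pullback X.hom Y'.hom}
    (h₁ : a ≫ pullback.fst X.hom Y'.hom = b ≫ pullback.fst X.hom Y'.hom)
    (h₂ : a ≫ pullback.snd X.hom Y'.hom ≫ c = b ≫ pullback.snd X.hom Y'.hom ≫ c) : a = b := by
  apply pullback.hom_ext h₁
  apply hc.hom_ext
  · simpa using h₂
  · rw [Category.assoc, Category.assoc, ← pullback.condition, reassoc_of% h₁]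

@[simp]
theorem pasteHom_pasteInv : pasteHom hc X ≫ pasteInv hc X = 𝟙 _ := by
  apply paste_ext hc X <;>
    simp only [Category.assoc, pasteInv_fst, pasteInv_snd, pasteHom_fst, pasteHom_snd,
      Category.id_comp]

@[simp]
theorem pasteInv_pasteHom : pasteInv hc X ≫ pasteHom hc X = 𝟙 _ := by
  apply pullback.hom_ext <;>
    simp only [Category.assoc, pasteInv_fst, pasteInv_snd, pasteHom_fst, pasteHom_snd,
      Category.id_comp]

theorem pasteHom_pasteInv_assoc {Z : C} (h : pullback X.hom Y'.hom ⟶ Z) :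
    pasteHom hc X ≫ pasteInv hc X ≫ h = h := by
  rw [← Category.assoc, pasteHom_pasteInv, Category.id_comp]

theorem pasteInv_pasteHom_assoc {Z : C}
    (h : pullback ((Over.map g).obj X).hom Y.hom ⟶ Z) :
    pasteInv hc X ≫ pasteHom hc X ≫ h = h := by
  rw [← Category.assoc, pasteInv_pasteHom, Category.id_comp]

instance : IsIso (pasteInv hc X) :=
  ⟨pasteHom hc X, pasteInv_pasteHom hc X, pasteHom_pasteInv hc X⟩

theorem pasteInv_testMap {X' X : Over B'} (t : X' ⟶ X) : pasteInv hc X' ≫ testMap t Y' =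
    testMap ((Over.map g).map t) Y ≫ pasteInv hc X := by
  apply paste_ext hc X
  · simp only [Category.assoc, pasteInv_fst, testMap_fst, reassoc_of% @pasteInv_fst, Over.map_map_left]
  · simp only [Category.assoc, pasteInv_snd, testMap_snd, reassoc_of% @testMap_snd]

theorem pasteInv_testMap_assoc {X' X : Over B'} (t : X' ⟶ X) {Z : C}
    (h : pullback X.hom Y'.hom ⟶ Z) : pasteInv hc X' ≫ testMap t Y' ≫ h =
      testMap ((Over.map g).map t) Y ≫ pasteInv hc X ≫ h := by
  rw [← Category.assoc, pasteInv_testMap, Category.assoc]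

theorem pasteInv_baseMap {E : Over B} {E' : Over B'} {cE : E'.left ⟶ E.left}
    (hE : IsPullback cE E'.hom E.hom g) {s : Y ⟶ E} {s' : Y' ⟶ E'}
    (hs : s'.left ≫ cE = c ≫ s.left) :
    pasteInv hc X ≫ baseMap X s' = baseMap ((Over.map g).obj X) s ≫ pasteInv hE X := by
  apply paste_ext hE X
  · simp only [Category.assoc, pasteInv_fst, baseMap_fst]
  · simp only [Category.assoc, pasteInv_snd, baseMap_snd, reassoc_of% @baseMap_snd, hs,
      reassoc_of% @pasteInv_snd]

theorem pasteInv_baseMap_assoc {E : Over B} {E' : Over B'} {cE : E'.left ⟶ E.left}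
    (hE : IsPullback cE E'.hom E.hom g) {s : Y ⟶ E} {s' : Y' ⟶ E'}
    (hs : s'.left ≫ cE = c ≫ s.left) {Z : C} (h : pullback X.hom E'.hom ⟶ Z) :
    pasteInv hc X ≫ baseMap X s' ≫ h =
      baseMap ((Over.map g).obj X) s ≫ pasteInv hE X ≫ h := by
  rw [← Category.assoc, pasteInv_baseMap hc X hE hs, Category.assoc]

end Paste

/-- Reindexing of lifting structures along `g : B' ⟶ B`: if `s'` is the pullback of `s` along `g`
then the lift of `X ×_{B'} s' ≅ X ×_B s` is the one given over `B`. -/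
def LiftingStructure.reindex {Ut U : C} {π : Ut ⟶ U} {B B' : C} {Y E : Over B} {s : Y ⟶ E}
    (F : LiftingStructure π s) {g : B' ⟶ B} {Y' E' : Over B'} (s' : Y' ⟶ E')
    {cY : Y'.left ⟶ Y.left} {cE : E'.left ⟶ E.left}
    (hY : IsPullback cY Y'.hom Y.hom g) (hE : IsPullback cE E'.hom E.hom g)
    (hs : s'.left ≫ cE = cY ≫ s.left) : LiftingStructure π s' where
  lift X u v w := pasteHom hE X ≫
    F.lift ((Over.map g).obj X) (pasteInv hY X ≫ u) (pasteInv hE X ≫ v)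
      (by rw [Category.assoc, w, pasteInv_baseMap_assoc hY X hE hs])
  upper X u v w := by
    rw [← cancel_epi (pasteInv hY X), pasteInv_baseMap_assoc hY X hE hs, pasteInv_pasteHom_assoc,
      F.upper]
  lower X u v w := by rw [Category.assoc, F.lower, pasteHom_pasteInv_assoc]
  uniform {X' X} t u v w := by
    have h := F.uniform ((Over.map g).map t) (pasteInv hY X ≫ u) (pasteInv hE X ≫ v)
      (by rw [Category.assoc, w, pasteInv_baseMap_assoc hY X hE hs])
    refine (cancel_epi (pasteInv hE X')).1 ((pasteInv_pasteHom_assoc hE X' _).trans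
      (Eq.trans ?_ (pasteInv_testMap_assoc hE t _).symm))
    refine Eq.trans ?_ (h.trans (congrArg _ (pasteInv_pasteHom_assoc hE X _).symm))
    congr 1
    · rw [pasteInv_testMap_assoc]
    · rw [pasteInv_testMap_assoc]

/-! ### The Beck-Chevalley map -/

section BeckChevalley

variable {Ut U : C} {π : Ut ⟶ U} [ChosenPullbacksAlong π] [ExponentiableMorphism π]
  {A B A' B' : C} {q : B ⟶ A} {q' : B' ⟶ A'} {f : A' ⟶ A} {g : B' ⟶ B}

/-- For `B'` the pullback of `B` and `Y'` the pullback of `Y`, and `T` over `A'`, the composite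
`B ×_A T ≅ B' ×_{A'} T ⟶ Y' ⟶ Y` over `B` determined by a map `B' ×_{A'} T ⟶ Y'` over `B'`. -/
def transposeAux (sq : IsPullback g q' q f) {Y : Over B} {Y' : Over B'} {c : Y'.left ⟶ Y.left}
    (hc : IsPullback c Y'.hom Y.hom g) (T : Over A') (k : (Over.pullback q').obj T ⟶ Y') :
    (Over.pullback q).obj ((Over.map f).obj T) ⟶ Y :=
  Over.homMk (pasteInv (Y := Over.mk q) (Y' := Over.mk q') sq T ≫ k.left ≫ c) (by
    have h1 : k.left ≫ Y'.hom = pullback.snd T.hom q' := Over.w k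
    have h2 : pasteInv (Y := Over.mk q) (Y' := Over.mk q') sq T ≫ pullback.snd T.hom q' ≫ g =
        pullback.snd ((Over.map f).obj T).hom q := pasteInv_snd (Y := Over.mk q) sq T
    rw [Category.assoc, Category.assoc, hc.w, reassoc_of% h1]
    exact h2)

/-- The Beck-Chevalley map `(f^* q)_* (f^* Y) ⟶ q_* Y` over `f`, where `B'` and `Y'` are the
pullbacks of `B` and `Y`: the transpose of
`B ×_A (q'_* Y') ≅ B' ×_{A'} (q'_* Y') ⟶ Y' ⟶ Y`, whose middle map is the counit. -/
def beckChevalley (sq : IsPullback g q' q f) (hq : IsFibration π q) (hq' : IsFibration π q')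
    {Y : Over B} {Y' : Over B'} {c : Y'.left ⟶ Y.left} (hc : IsPullback c Y'.hom Y.hom g) :
    ((pushforward q' hq').obj Y').left ⟶ ((pushforward q hq).obj Y).left :=
  ((pushforwardAdj q hq).homEquiv ((Over.map f).obj ((pushforward q' hq').obj Y')) Y
    (transposeAux sq hc _ ((pushforwardAdj q' hq').counit.app Y'))).left

theorem map_transposeAux (sq : IsPullback g q' q f) {Y : Over B} {Y' : Over B'}
    {c : Y'.left ⟶ Y.left} (hc : IsPullback c Y'.hom Y.hom g) {S T : Over A'} (t : S ⟶ T)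
    (k : (Over.pullback q').obj T ⟶ Y') :
    (Over.pullback q).map ((Over.map f).map t) ≫ transposeAux sq hc T k =
      transposeAux sq hc S ((Over.pullback q').map t ≫ k) := by
  ext
  have h := pasteInv_testMap_assoc (Y := Over.mk q) (Y' := Over.mk q') sq t (k.left ≫ c)
  simp only [transposeAux, Over.comp_left, Over.homMk_left, Category.assoc]
  exact h.symm

theorem transposeAux_bijective (sq : IsPullback g q' q f) {Y : Over B} {Y' : Over B'}
    {c : Y'.left ⟶ Y.left} (hc : IsPullback c Y'.hom Y.hom g) (T : Over A') :
    Function.Bijective (transposeAux sq hc T) := by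
  constructor
  · intro k l h
    have h := congrArg CommaMorphism.left h
    ext
    apply hc.hom_ext
    · exact (cancel_epi (pasteInv (Y := Over.mk q) (Y' := Over.mk q') sq T)).1 h
    · exact (Over.w k).trans (Over.w l).symm
  · intro a
    have ha : a.left ≫ Y.hom = pullback.snd ((Over.map f).obj T).hom q := Over.w a
    have hs : pasteHom (Y := Over.mk q) (Y' := Over.mk q') sq T ≫
        pullback.snd ((Over.map f).obj T).hom q = pullback.snd T.hom q' ≫ g :=
      pasteHom_snd (Y := Over.mk q) (Y' := Over.mk q') sq T
    refine ⟨Over.homMk (hc.lift (pasteHom (Y := Over.mk q) (Y' := Over.mk q') sq T ≫ a.left)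
      (pullback.snd T.hom q') ?_) (hc.lift_snd _ _ _), ?_⟩
    · rw [Category.assoc, ha]
      exact hs
    · ext
      simp only [transposeAux, Over.homMk_left, hc.lift_fst]
      exact pasteInv_pasteHom_assoc (Y := Over.mk q) (Y' := Over.mk q') sq T _

theorem transpose_beckChevalley (sq : IsPullback g q' q f) (hq : IsFibration π q)
    (hq' : IsFibration π q') {Y : Over B} {Y' : Over B'} {c : Y'.left ⟶ Y.left}
    (hc : IsPullback c Y'.hom Y.hom g) {T : Over A'} (k : T ⟶ (pushforward q' hq').obj Y') :
    k.left ≫ beckChevalley sq hq hq' hc = ((pushforwardAdj q hq).homEquiv _ _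
      (transposeAux sq hc T (((pushforwardAdj q' hq').homEquiv _ _).symm k))).left := by
  rw [Adjunction.homEquiv_counit, ← map_transposeAux, Adjunction.homEquiv_naturality_left]
  rfl

theorem beckChevalley_w (sq : IsPullback g q' q f) (hq : IsFibration π q)
    (hq' : IsFibration π q') {Y : Over B} {Y' : Over B'} {c : Y'.left ⟶ Y.left}
    (hc : IsPullback c Y'.hom Y.hom g) :
    beckChevalley sq hq hq' hc ≫ ((pushforward q hq).obj Y).hom =
      ((pushforward q' hq').obj Y').hom ≫ f :=
  Over.w ((pushforwardAdj q hq).homEquiv ((Over.map f).obj ((pushforward q' hq').obj Y')) Y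
    (transposeAux sq hc _ ((pushforwardAdj q' hq').counit.app Y')))

theorem isPullback_beckChevalley (sq : IsPullback g q' q f) (hq : IsFibration π q)
    (hq' : IsFibration π q') {Y : Over B} {Y' : Over B'} {c : Y'.left ⟶ Y.left}
    (hc : IsPullback c Y'.hom Y.hom g) :
    IsPullback (beckChevalley sq hq hq' hc) ((pushforward q' hq').obj Y').hom
      ((pushforward q hq).obj Y).hom f := by
  have key : ∀ z : PullbackCone ((pushforward q hq).obj Y).hom f,
      ∃! l : z.pt ⟶ ((pushforward q' hq').obj Y').left,
        l ≫ beckChevalley sq hq hq' hc = z.fst ∧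
          l ≫ ((pushforward q' hq').obj Y').hom = z.snd := by
    intro z
    let T : Over A' := Over.mk z.snd
    let a : (Over.map f).obj T ⟶ (pushforward q hq).obj Y := Over.homMk z.fst z.condition
    have e := fun k : T ⟶ (pushforward q' hq').obj Y' => transpose_beckChevalley sq hq hq' hc k
    have inj : ∀ k : T ⟶ (pushforward q' hq').obj Y',
        k.left ≫ beckChevalley sq hq hq' hc = z.fst ↔
          transposeAux sq hc T (((pushforwardAdj q' hq').homEquiv _ _).symm k) =
            ((pushforwardAdj q hq).homEquiv _ _).symm a := by
      intro k
      rw [e, Equiv.eq_symm_apply]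
      exact ⟨fun h => Over.OverMorphism.ext h, fun h => congrArg CommaMorphism.left h⟩
    obtain ⟨k, hk⟩ := (transposeAux_bijective sq hc T).2 (((pushforwardAdj q hq).homEquiv _ _).symm a)
    refine ⟨(((pushforwardAdj q' hq').homEquiv _ _) k).left, ⟨(inj _).2 (by simpa using hk),
      Over.w _⟩, ?_⟩
    rintro l ⟨h1, h2⟩
    have h3 := (inj (Over.homMk l h2)).1 h1
    rw [← hk] at h3
    have h4 := (Equiv.symm_apply_eq _).1 ((transposeAux_bijective sq hc T).1 h3)
    exact congrArg CommaMorphism.left h4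
  exact ⟨⟨beckChevalley_w sq hq hq' hc⟩, ⟨PullbackCone.IsLimit.mk _ (fun z => (key z).choose)
    (fun z => (key z).choose_spec.1.1) (fun z => (key z).choose_spec.1.2)
    (fun z m h1 h2 => (key z).choose_spec.2 m ⟨h1, h2⟩)⟩⟩

theorem beckChevalley_naturality (sq : IsPullback g q' q f) (hq : IsFibration π q)
    (hq' : IsFibration π q') {Y E : Over B} {Y' E' : Over B'} {s : Y ⟶ E} {s' : Y' ⟶ E'}
    {cY : Y'.left ⟶ Y.left} {cE : E'.left ⟶ E.left}
    (hY : IsPullback cY Y'.hom Y.hom g) (hE : IsPullback cE E'.hom E.hom g)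
    (hs : s'.left ≫ cE = cY ≫ s.left) :
    ((pushforward q' hq').map s').left ≫ beckChevalley sq hq hq' hE =
      beckChevalley sq hq hq' hY ≫ ((pushforward q hq).map s).left := by
  rw [transpose_beckChevalley, beckChevalley, ← Over.comp_left,
    ← Adjunction.homEquiv_naturality_right]
  congr 2
  ext
  simp only [transposeAux, Over.comp_left, Over.homMk_left, Category.assoc, ← hs]
  congr 1
  rw [← Category.assoc]
  congr 1
  rw [← Over.comp_left]
  congr 1
  simp [Adjunction.homEquiv_counit]

end BeckChevalley

/-! ### Type-theoretic structure on a universal map -/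

section Structures

variable {Ut U : C} (π : Ut ⟶ U) [ChosenPullbacksAlong π] [ExponentiableMorphism π]

/-- The polynomial functor `P_π`, regarded as taking values over `U`: `Z ↦ π_* (Ut × Z)`. -/
def polyOver : C ⥤ Over U := Over.star Ut ⋙ ExponentiableMorphism.pushforward π

/-- The polynomial functor `P_π : C ⥤ C`. -/
def poly : C ⥤ C := polyOver π ⋙ Over.forget U

/-- A `Π`-type structure on `π`: a `π`-fibrancy structure on `P_π(π) : P_π(Ut) ⟶ P_π(U)`. -/
abbrev PiStructure := FibrancyStructure π ((poly π).map π)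

/-- A pre-`Id`-type structure on `π`: maps `Id : Ut ×_U Ut ⟶ U` and `⌈refl⌉ : Ut ⟶ Ut` forming a
commutative square from the diagonal of `π` to `π`. -/
structure PreIdStructure where
  Id : pullback π π ⟶ U
  reflPoint : Ut ⟶ Ut
  comm : reflPoint ≫ π = pullback.diagonal π ≫ Id

variable {π}

namespace PreIdStructure

variable (I : PreIdStructure π)

/-- `Id_U(Ut)`, the selected pullback of `π` along `Id`, as an object over `U`. -/
def idOver : Over U :=
  Over.mk (ChosenPullbacksAlong.fst I.Id π ≫ pullback.fst π π ≫ π)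

/-- `refl : Ut ⟶ Id_U(Ut)` over `U`. -/
def refl : Over.mk π ⟶ I.idOver :=
  Over.homMk (ChosenPullbacksAlong.lift (pullback.diagonal π) I.reflPoint I.comm.symm) (by
    simp [idOver])

end PreIdStructure

variable (π)

/-- A (full) `Id`-type structure on `π`: a pre-`Id`-type structure together with a `J`-elimination
structure, i.e. a lifting structure of `refl : Ut ⟶ Id_U(Ut)` against `U × π` over `U`. -/
structure IdStructure extends PreIdStructure π where
  J : LiftingStructure π toPreIdStructure.refl

variable {π}

/-- A pointed `Id`-functional extensionality structure: a lifting structure of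
`P_π(refl) : P_π(Ut) ⟶ P_π(Id_U(Ut))` against `U × π` over `U`. -/
abbrev PtdFunExt (I : IdStructure π) := LiftingStructure π ((polyOver π).map I.refl.left)

end Structures

/-! ### Families of maps between lifting structures -/

section Family

variable {Ut U : C} (π : Ut ⟶ U) [ChosenPullbacksAlong π] [ExponentiableMorphism π]

/-- A reindexing-stable family of maps `(s ⧄_B (B × π)) ⟶ (q_* s ⧄_A (A × π))`, indexed by a
`π`-fibration `q : B ⟶ A` and a map `s : Y ⟶ E` between `π`-fibrant objects over `B`, where `q`, `Y`
and `E` carry fibrancy structures. Stability: for `f : A' ⟶ A`, and `q'`, `Y'`, `E'`, `s'` the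
pullbacks of `q`, `Y`, `E`, `s` along `f` with the induced fibrancy structures, the map at `(q', s')`
takes the reindexing of `F` to the reindexing of the image of `F`, with `q'_* s'` identified with
the pullback of `q_* s` along `f` by the Beck-Chevalley isomorphism. -/
structure PushforwardFamily where
  map {A B : C} (q : B ⟶ A) (hq : FibrancyStructure π q) {Y E : Over B}
    (hY : FibrancyStructure π Y.hom) (hE : FibrancyStructure π E.hom) (s : Y ⟶ E) :
    LiftingStructure π s → LiftingStructure π ((pushforward q hq.isFibration).map s)
  map_reindex {A B : C} (q : B ⟶ A) (hq : FibrancyStructure π q) {Y E : Over B}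
    (hY : FibrancyStructure π Y.hom) (hE : FibrancyStructure π E.hom) (s : Y ⟶ E)
    (F : LiftingStructure π s)
    {A' B' : C} {q' : B' ⟶ A'} {f : A' ⟶ A} {g : B' ⟶ B} (sq : IsPullback g q' q f)
    {Y' E' : Over B'} (s' : Y' ⟶ E') {cY : Y'.left ⟶ Y.left} {cE : E'.left ⟶ E.left}
    (hcY : IsPullback cY Y'.hom Y.hom g) (hcE : IsPullback cE E'.hom E.hom g)
    (hs : s'.left ≫ cE = cY ≫ s.left) :
    map q' (hq.pullback sq) (hY.pullback hcY) (hE.pullback hcE) s' (F.reindex s' hcY hcE hs) =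
      (map q hq hY hE s F).reindex ((pushforward q' (hq.pullback sq).isFibration).map s')
        (isPullback_beckChevalley sq hq.isFibration (hq.pullback sq).isFibration hcY)
        (isPullback_beckChevalley sq hq.isFibration (hq.pullback sq).isFibration hcE)
        (beckChevalley_naturality sq hq.isFibration (hq.pullback sq).isFibration hcY hcE hs)

end Family

/-! ### The generic case and restriction of a family -/

section Selected

variable {Ut U : C} (π : Ut ⟶ U) [ChosenPullbacksAlong π]

/-- The selected pullback of `W` over `U` along `π`. -/
abbrev sel (W : Over U) : C := ((ChosenPullbacksAlong.pullback π).obj W).left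

/-- The projection `π^* W ⟶ W`. -/
def selFst (W : Over U) : sel π W ⟶ W.left := ChosenPullbacksAlong.fst W.hom π

/-- The projection `π^* W ⟶ Ut`. -/
def selSnd (W : Over U) : sel π W ⟶ Ut := ChosenPullbacksAlong.snd W.hom π

theorem isPullback_sel (W : Over U) : IsPullback (selFst π W) (selSnd π W) W.hom π :=
  ChosenPullbacksAlong.isPullback W.hom π

theorem selMap_fst {W W' : Over U} (k : W ⟶ W') :
    ((ChosenPullbacksAlong.pullback π).map k).left ≫ selFst π W' = selFst π W ≫ k.left :=
  congrArg CommaMorphism.left ((ChosenPullbacksAlong.mapPullbackAdj π).counit.naturality k)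

theorem selMap_snd {W W' : Over U} (k : W ⟶ W') :
    ((ChosenPullbacksAlong.pullback π).map k).left ≫ selSnd π W' = selSnd π W :=
  Over.w ((ChosenPullbacksAlong.pullback π).map k)

end Selected

section Generic

variable {Ut U : C} (π : Ut ⟶ U) [ChosenPullbacksAlong π] [ExponentiableMorphism π]

/-- `P_π(U) = π_* (Ut × U)`, which classifies a `π`-fibration together with a family of types over
its total space. -/
abbrev genBase : C := ((polyOver π).obj U).left

/-- The structure map `P_π(U) ⟶ U`. -/
abbrev genName : genBase π ⟶ U := ((polyOver π).obj U).hom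

/-- `π^* P_π(U)`. -/
abbrev genTotal : C := sel π ((polyOver π).obj U)

/-- The generic `π`-fibration `π^* P_π(U) ⟶ P_π(U)`. -/
abbrev genFib : genTotal π ⟶ genBase π := selFst π ((polyOver π).obj U)

/-- The evaluation `π^* P_π(Z) ⟶ Ut × Z ⟶ Z`. -/
def genEval (Z : C) : sel π ((polyOver π).obj Z) ⟶ Z :=
  ((ExponentiableMorphism.ev π).app ((Over.star Ut).obj Z)).left ≫ prod.snd

theorem genEval_naturality {Z Z' : C} (k : Z ⟶ Z') :
    ((ChosenPullbacksAlong.pullback π).map ((polyOver π).map k)).left ≫ genEval π Z' =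
      genEval π Z ≫ k := by
  have h := congrArg CommaMorphism.left
    (ExponentiableMorphism.ev_naturality (f := π) ((Over.star Ut).map k))
  have h2 : ((Over.star Ut).map k).left ≫ prod.snd = prod.snd ≫ k := prod.map_snd _ _
  refine (Category.assoc _ _ _).symm.trans ?_
  refine (congrArg (· ≫ prod.snd) h).trans ?_
  refine (Category.assoc _ _ _).trans ?_
  refine (congrArg _ h2).trans ?_
  exact (Category.assoc _ _ _).symm

/-- The fibrancy structure of the generic `π`-fibration. -/
def genFibrancy : FibrancyStructure π (genFib π) where
  name := genName π
  point := selSnd π ((polyOver π).obj U)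
  isPullback := (isPullback_sel π ((polyOver π).obj U)).flip

/-- For `Z` over `U`, its pullback `ev^* Z` along `ev : π^* P_π(U) ⟶ U`. -/
abbrev genPull : Over U ⥤ Over (genTotal π) := Over.pullback (genEval π U)

variable {π} in
/-- A fibrancy structure of `Z` over `U` induces one of `ev^* Z`. -/
def genPullFibrancy {Z : Over U} (h : FibrancyStructure π Z.hom) :
    FibrancyStructure π ((genPull π).obj Z).hom :=
  h.pullback (IsPullback.of_hasPullback Z.hom (genEval π U))

/-- For `Z` over `U`, the map `P_π(Z) ⟶ P_π(U)`. -/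
abbrev genMap (Z : Over U) : ((polyOver π).obj Z.left).left ⟶ genBase π :=
  ((polyOver π).map Z.hom).left

theorem genMap_name (Z : Over U) :
    genMap π Z ≫ genName π = ((polyOver π).obj Z.left).hom :=
  Over.w ((polyOver π).map Z.hom)

theorem map_genMap {Z Z' : Over U} (k : Z ⟶ Z') :
    ((polyOver π).map k.left).left ≫ genMap π Z' = genMap π Z := by
  rw [genMap, genMap, ← Over.comp_left, ← Functor.map_comp, Over.w]

/-- The map `P_π(Z) ×_{P_π(U)} π^* P_π(U) ⟶ π^* P_π(Z)`. -/
def genProj (Z : Over U) :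
    pullback (genMap π Z) (genFib π) ⟶ sel π ((polyOver π).obj Z.left) :=
  (isPullback_sel π ((polyOver π).obj Z.left)).lift (pullback.fst _ _)
    (pullback.snd _ _ ≫ selSnd π ((polyOver π).obj U)) (by
      rw [← genMap_name, pullback.condition_assoc, Category.assoc,
        (isPullback_sel π ((polyOver π).obj U)).w])

theorem genProj_fst (Z : Over U) : genProj π Z ≫ selFst π ((polyOver π).obj Z.left) =
    pullback.fst (genMap π Z) (genFib π) := IsPullback.lift_fst _ _ _ _

theorem genProj_snd (Z : Over U) : genProj π Z ≫ selSnd π ((polyOver π).obj Z.left) =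
    pullback.snd (genMap π Z) (genFib π) ≫ selSnd π ((polyOver π).obj U) :=
  IsPullback.lift_snd _ _ _ _

theorem genProj_eval (Z : Over U) :
    (genProj π Z ≫ genEval π Z.left) ≫ Z.hom =
      pullback.snd (genMap π Z) (genFib π) ≫ genEval π U := by
  rw [Category.assoc, ← genEval_naturality, ← Category.assoc]
  congr 1
  apply (isPullback_sel π ((polyOver π).obj U)).hom_ext
  · rw [Category.assoc, selMap_fst, reassoc_of% @genProj_fst, pullback.condition]
  · rw [Category.assoc, selMap_snd, genProj_snd]

/-- Evaluation `P_π(Z) ×_{P_π(U)} π^* P_π(U) ⟶ ev^* Z`. -/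
def genTranspose (Z : Over U) :
    (Over.pullback (genFib π)).obj (Over.mk (genMap π Z)) ⟶ (genPull π).obj Z :=
  Over.homMk (pullback.lift (genProj π Z ≫ genEval π Z.left)
    (pullback.snd (genMap π Z) (genFib π)) (genProj_eval π Z)) (pullback.lift_snd _ _ _)

/-- The canonical comparison `P_π(Z) ⟶ q_* (ev^* Z)` over `P_π(U)`, for `Z` over `U` and `q` the
generic `π`-fibration (an isomorphism by distributivity): the transpose of evaluation. -/
def genCompare (Z : Over U) : Over.mk (genMap π Z) ⟶
    (pushforward (genFib π) (genFibrancy π).isFibration).obj ((genPull π).obj Z) :=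
  (pushforwardAdj (genFib π) (genFibrancy π).isFibration).homEquiv _ _ (genTranspose π Z)

theorem genTranspose_naturality {Z Z' : Over U} (k : Z ⟶ Z') :
    genTranspose π Z ≫ (genPull π).map k =
      (Over.pullback (genFib π)).map (Over.homMk ((polyOver π).map k.left).left
        (map_genMap π k) : Over.mk (genMap π Z) ⟶ Over.mk (genMap π Z')) ≫ genTranspose π Z' := by
  let m : pullback (genMap π Z) (genFib π) ⟶ pullback (genMap π Z') (genFib π) :=
    pullback.lift (pullback.fst _ _ ≫ ((polyOver π).map k.left).left) (pullback.snd _ _)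
      (by rw [Category.assoc, map_genMap, pullback.condition])
  have hm1 : m ≫ pullback.fst _ _ = pullback.fst _ _ ≫ ((polyOver π).map k.left).left :=
    pullback.lift_fst _ _ _
  have hm2 : m ≫ pullback.snd _ _ = pullback.snd _ _ := pullback.lift_snd _ _ _
  have hp : m ≫ genProj π Z' =
      genProj π Z ≫ ((ChosenPullbacksAlong.pullback π).map ((polyOver π).map k.left)).left := by
    apply (isPullback_sel π ((polyOver π).obj Z'.left)).hom_ext
    · rw [Category.assoc, Category.assoc, selMap_fst, genProj_fst, reassoc_of% @genProj_fst, hm1]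
    · rw [Category.assoc, Category.assoc, selMap_snd, genProj_snd, genProj_snd,
        reassoc_of% hm2]
  let r (Z : Over U) : pullback (genMap π Z) (genFib π) ⟶ pullback Z.hom (genEval π U) :=
    pullback.lift (genProj π Z ≫ genEval π Z.left) (pullback.snd (genMap π Z) (genFib π))
      (genProj_eval π Z)
  let p : pullback Z.hom (genEval π U) ⟶ pullback Z'.hom (genEval π U) :=
    pullback.lift (pullback.fst _ _ ≫ k.left) (pullback.snd _ _)
      (by rw [Category.assoc, Over.w, pullback.condition])
  have h : r Z ≫ p = m ≫ r Z' := by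
    apply pullback.hom_ext
    · simp only [r, p, Category.assoc, pullback.lift_fst, pullback.lift_fst_assoc,
        reassoc_of% hp, genEval_naturality]
    · simp only [r, p, Category.assoc, pullback.lift_snd, hm2]
  ext
  exact h

theorem genCompare_naturality {Z Z' : Over U} (k : Z ⟶ Z') :
    (genCompare π Z).left ≫ ((pushforward (genFib π) (genFibrancy π).isFibration).map
      ((genPull π).map k)).left = ((polyOver π).map k.left).left ≫ (genCompare π Z').left := by
  suffices h : genCompare π Z ≫ (pushforward (genFib π) (genFibrancy π).isFibration).map
      ((genPull π).map k) = (Over.homMk ((polyOver π).map k.left).left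
        (map_genMap π k) : Over.mk (genMap π Z) ⟶ Over.mk (genMap π Z')) ≫ genCompare π Z' from
    congrArg CommaMorphism.left h
  rw [genCompare, genCompare, ← Adjunction.homEquiv_naturality_left,
    ← Adjunction.homEquiv_naturality_right, genTranspose_naturality]

theorem genCompare_w (Z : Over U) : (genCompare π Z).left ≫
    ((pushforward (genFib π) (genFibrancy π).isFibration).obj ((genPull π).obj Z)).hom =
      genMap π Z := Over.w (genCompare π Z)

/-- For `X` and `Z` over `U`, the map `X ×_U P_π(Z) ⟶ X ×_U P_π(U)`. -/
def genSplitBase (X Z : Over U) : pullback X.hom ((polyOver π).obj Z.left).hom ⟶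
    pullback X.hom (genName π) :=
  pullback.lift (pullback.fst _ _) (pullback.snd _ _ ≫ genMap π Z)
    (by rw [Category.assoc, genMap_name, pullback.condition])

/-- For `X` and `Z` over `U`, the canonical comparison
`X ×_U P_π(Z) ⟶ (X ×_U P_π(U)) ×_{P_π(U)} q_* (ev^* Z)` (an isomorphism). -/
def genSplit (X Z : Over U) : pullback X.hom ((polyOver π).obj Z.left).hom ⟶
    pullback ((Over.pullback (genName π)).obj X).hom
      ((pushforward (genFib π) (genFibrancy π).isFibration).obj ((genPull π).obj Z)).hom :=
  pullback.lift (genSplitBase π X Z) (pullback.snd _ _ ≫ (genCompare π Z).left) (by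
    refine (pullback.lift_snd _ _ _).trans ?_
    rw [Category.assoc, genCompare_w])

theorem genSplit_fst (X Z : Over U) : genSplit π X Z ≫ pullback.fst _ _ = genSplitBase π X Z :=
  pullback.lift_fst _ _ _

theorem genSplit_snd (X Z : Over U) :
    genSplit π X Z ≫ pullback.snd _ _ = pullback.snd _ _ ≫ (genCompare π Z).left :=
  pullback.lift_snd _ _ _

theorem genSplit_naturality (X : Over U) {Z Z' : Over U} (k : Z ⟶ Z') :
    genSplit π X Z ≫ baseMap ((Over.pullback (genName π)).obj X)
      ((pushforward (genFib π) (genFibrancy π).isFibration).map ((genPull π).map k)) =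
    baseMap X ((polyOver π).map k.left) ≫ genSplit π X Z' := by
  apply pullback.hom_ext
  · rw [Category.assoc, Category.assoc, genSplit_fst, baseMap_fst, genSplit_fst]
    apply pullback.hom_ext
    · simp only [genSplitBase, Category.assoc, pullback.lift_fst, baseMap_fst]
    · simp only [genSplitBase, Category.assoc, pullback.lift_snd, reassoc_of% @baseMap_snd, map_genMap]
  · rw [Category.assoc, Category.assoc, genSplit_snd, baseMap_snd, reassoc_of% @genSplit_snd,
      reassoc_of% @baseMap_snd, genCompare_naturality]

variable {π}

/-- The value of a family at the generic `π`-fibration `q : π^* P_π(U) ⟶ P_π(U)`, at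
`s = ev^*(refl)`, and at the lifting structure of `s` given by `J`-elimination. The target of `s` is
`π`-fibrant by means of a fibrancy structure `σ` on `Id_U(Ut) ⟶ U`. -/
def PushforwardFamily.atRefl (φ : PushforwardFamily π) (I : IdStructure π)
    (σ : FibrancyStructure π I.idOver.hom) :
    LiftingStructure π
      ((pushforward (genFib π) (genFibrancy π).isFibration).map ((genPull π).map I.refl)) :=
  φ.map (genFib π) (genFibrancy π)
    (genPullFibrancy (Z := Over.mk π) (FibrancyStructure.self π))
    (genPullFibrancy σ) ((genPull π).map I.refl)
    (I.J.reindex ((genPull π).map I.refl)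
      (IsPullback.of_hasPullback (Over.mk π).hom (genEval π U))
      (IsPullback.of_hasPullback I.idOver.hom (genEval π U)) (pullback.lift_fst _ _ _))

/-- A pointed functional extensionality structure `F` is the restriction of the family `φ` when, for
`X` over `U`, the lifts of `X ×_U P_π(refl)` given by `F` are those given by `φ.atRefl` for
`(X ×_U P_π(U)) ×_{P_π(U)} q_* (ev^* refl)`, under the canonical isomorphisms `genSplit`. -/
def PushforwardFamily.RestrictsTo (φ : PushforwardFamily π) (I : IdStructure π)
    (σ : FibrancyStructure π I.idOver.hom) (F : PtdFunExt I) : Prop :=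
  ∀ (X : Over U) (u) (v) (w),
    F.lift X (genSplit π X (Over.mk π) ≫ u) (genSplit π X I.idOver ≫ v)
      ((Category.assoc _ _ _).trans ((congrArg _ w).trans (by
        rw [← Category.assoc, genSplit_naturality, Category.assoc]))) =
      genSplit π X I.idOver ≫
        (φ.atRefl I σ).lift ((Over.pullback (genName π)).obj X) u v w

end Generic

end UniverseCategory

end

open UniverseCategory

noncomputable section

namespace UniverseCategory

universe v u

variable {C : Type u} [Category.{v} C] [HasFiniteLimits C]

set_option linter.unusedSectionVars false

/-! ### The universal property of the polynomial functor -/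

section Curry

variable {Ut U : C} (π : Ut ⟶ U) [ChosenPullbacksAlong π] [ExponentiableMorphism π]

/-! For a map `s : Y ⟶ E` between fibrant objects over `B`, having a lifting structure amounts to
being the section of a homotopy retraction: a map `r` over `B` with `s ≫ r = 𝟙` and a homotopy `h`,
valued in the identity type of `E`, from `r ≫ s` to the identity and constant on `s`. Given lifts,
`r` extends the identity of `Y` along `s`, and `h` extends reflexivity
(`LiftingStructure.homotopyRetraction`). Given `(r, h)`, a lifting problem `(u, v)` is solved at `x`
by transporting `u (r x)`, of type `v (s (r x))`, along `h x` into `v x`; since `h` is constant on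
`s` and transport along reflexivity is strictly the identity, this extends `u`
(`HomotopyRetraction.liftingStructure`). Transport is `J`-elimination into function types, which
come from the `Π`-type structure.

Homotopy retractions pass through `q_*`. The retraction does so by functoriality. The homotopy `E ⟶
Id_U(Ut)` induces `q_* E ⟶ P_π(Id_U(Ut))`, and `IdStructure.funExt` turns a family of
identifications into an identification of abstractions. Pointedness, that is
`IdStructure.refl_funExt`, is what keeps the new homotopy constant on `q_* s`. The object `q_* E` is
again fibrant, being a pullback of `P_π(π)` (`pushforwardFibrancy`). Composing the three passages
gives (1), hence (3).

Stability holds because each passage respects base change: fillers by uniformity of lifts, maps into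
`P_π(Z)` by uniqueness, and the names and points of `q_* E` agree on the nose along the
Beck-Chevalley map. The relation `HomotopyRetraction.IsBaseChange` carries this through.

For (2), a map into `P_π(Z)` over `P_π(U)` is the same as a map into `ev^* Z` over the generic
fibration, so `P_π(Z) ≅ q_* (ev^* Z)`. Hence the comparisons `genSplit` are invertible, and
conjugating the lifts of the family by them gives the required structure.

Everything rests on the universal property `existsUnique_uncurry` of `P_π(Z)`. -/

/-- `P_π(Z)`. -/
abbrev polyObj (Z : C) : C := ((polyOver π).obj Z).left

/-- The structure map `P_π(Z) ⟶ U`. -/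
abbrev polyName (Z : C) : polyObj π Z ⟶ U := ((polyOver π).obj Z).hom

/-- The map `P_π(k) : P_π(Z) ⟶ P_π(Z')`. -/
abbrev polyMap {Z Z' : C} (k : Z ⟶ Z') : polyObj π Z ⟶ polyObj π Z' := ((polyOver π).map k).left

theorem polyMap_name {Z Z' : C} (k : Z ⟶ Z') : polyMap π k ≫ polyName π Z' = polyName π Z :=
  Over.w ((polyOver π).map k)

theorem polyMap_id (Z : C) : polyMap π (𝟙 Z) = 𝟙 _ := by
  rw [polyMap, CategoryTheory.Functor.map_id, Over.id_left]

theorem polyMap_comp {Z Z' Z'' : C} (k : Z ⟶ Z') (l : Z' ⟶ Z'') :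
    polyMap π (k ≫ l) = polyMap π k ≫ polyMap π l := by
  rw [polyMap, Functor.map_comp, Over.comp_left]

variable {π}

/-- The map `D ⟶ π^* P_π(Z)` induced by a map `Γ ⟶ P_π(Z)` over `U`, for `D ⟶ Γ` a pullback of
`π`. -/
def selLift {Γ D Z : C} {k : D ⟶ Ut} {p : D ⟶ Γ} {a : Γ ⟶ U} (sq : IsPullback k p π a)
    (c : Γ ⟶ polyObj π Z) (hc : c ≫ polyName π Z = a) : D ⟶ sel π ((polyOver π).obj Z) :=
  (isPullback_sel π ((polyOver π).obj Z)).lift (p ≫ c) k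
    (by rw [Category.assoc]; exact (congrArg (p ≫ ·) hc).trans sq.w.symm)

/-- The map `D ⟶ Z` named by a map `Γ ⟶ P_π(Z)` over `U`, for `D ⟶ Γ` a pullback of `π`. -/
def uncurry {Γ D Z : C} {k : D ⟶ Ut} {p : D ⟶ Γ} {a : Γ ⟶ U} (sq : IsPullback k p π a)
    (c : Γ ⟶ polyObj π Z) (hc : c ≫ polyName π Z = a) : D ⟶ Z :=
  selLift sq c hc ≫ genEval π Z

section

variable {Γ D Z : C} {k : D ⟶ Ut} {p : D ⟶ Γ} {a : Γ ⟶ U} (sq : IsPullback k p π a)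
  (c : Γ ⟶ polyObj π Z) (hc : c ≫ polyName π Z = a)

theorem selLift_fst : selLift sq c hc ≫ selFst π ((polyOver π).obj Z) = p ≫ c :=
  IsPullback.lift_fst _ _ _ _

theorem selLift_snd : selLift sq c hc ≫ selSnd π ((polyOver π).obj Z) = k :=
  IsPullback.lift_snd _ _ _ _

theorem uncurry_unique {t : D ⟶ sel π ((polyOver π).obj Z)} {f : D ⟶ Z}
    (h₁ : t ≫ selFst π ((polyOver π).obj Z) = p ≫ c)
    (h₂ : t ≫ selSnd π ((polyOver π).obj Z) = k) (hf : t ≫ genEval π Z = f) :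
    uncurry sq c hc = f := by
  rw [uncurry, ← hf]
  congr 1
  exact (isPullback_sel π ((polyOver π).obj Z)).hom_ext
    ((selLift_fst sq c hc).trans h₁.symm) ((selLift_snd sq c hc).trans h₂.symm)

end

theorem uncurry_comp {Γ Γ' D D' Z : C} {k : D ⟶ Ut} {p : D ⟶ Γ} {a : Γ ⟶ U} {k' : D' ⟶ Ut}
    {p' : D' ⟶ Γ'} {a' : Γ' ⟶ U} (sq : IsPullback k p π a) (sq' : IsPullback k' p' π a')
    {γ : Γ' ⟶ Γ} {δ : D' ⟶ D} (hk : δ ≫ k = k') (hp : δ ≫ p = p' ≫ γ)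
    (c : Γ ⟶ polyObj π Z) (hc : c ≫ polyName π Z = a) (hc' : (γ ≫ c) ≫ polyName π Z = a') :
    uncurry sq' (γ ≫ c) hc' = δ ≫ uncurry sq c hc := by
  refine uncurry_unique sq' _ hc' (t := δ ≫ selLift sq c hc) ?_ ?_ (Category.assoc _ _ _)
  · rw [Category.assoc, selLift_fst, reassoc_of% hp]
  · rw [Category.assoc, selLift_snd, hk]

theorem uncurry_map {Γ D Z Z' : C} {k : D ⟶ Ut} {p : D ⟶ Γ} {a : Γ ⟶ U}
    (sq : IsPullback k p π a) (c : Γ ⟶ polyObj π Z) (hc : c ≫ polyName π Z = a) (z : Z ⟶ Z')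
    (hc' : (c ≫ polyMap π z) ≫ polyName π Z' = a) :
    uncurry sq (c ≫ polyMap π z) hc' = uncurry sq c hc ≫ z := by
  refine uncurry_unique sq _ hc' (t := selLift sq c hc ≫
    ((ChosenPullbacksAlong.pullback π).map ((polyOver π).map z)).left) ?_ ?_ ?_
  · rw [Category.assoc, selMap_fst, ← Category.assoc, selLift_fst, Category.assoc]
  · rw [Category.assoc, selMap_snd, selLift_snd]
  · rw [uncurry, Category.assoc, Category.assoc, genEval_naturality]

theorem star_obj_hom (X Z : C) : ((Over.star X).obj Z).hom = prod.fst :=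
  (Over.star_obj_hom X Z).trans (prod.lift_fst _ _)

/-- The adjunction `π^* ⊣ π_*` combined with the fact that a map over `Ut` into `Ut × Z` is just a
map into `Z`. The pullback `D` is arbitrary because selected pullbacks, pullbacks given by limits
and those coming from fibrancy structures all occur below. -/
theorem existsUnique_uncurry {Γ D Z : C} {k : D ⟶ Ut} {p : D ⟶ Γ} {a : Γ ⟶ U}
    (sq : IsPullback k p π a) (f : D ⟶ Z) :
    ∃! c : Γ ⟶ polyObj π Z, ∃ hc : c ≫ polyName π Z = a, uncurry sq c hc = f := by
  let W : Over U := Over.mk a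
  let i : sel π W ≅ D := (isPullback_sel π W).isoIsPullback _ _ sq.flip
  have hi1 : i.hom ≫ p = selFst π W := IsPullback.isoIsPullback_hom_fst _ _ _ _
  have hi2 : i.hom ≫ k = selSnd π W := IsPullback.isoIsPullback_hom_snd _ _ _ _
  let e : ((ChosenPullbacksAlong.pullback π).obj W ⟶ (Over.star Ut).obj Z) ≃
      (W ⟶ (polyOver π).obj Z) :=
    (ExponentiableMorphism.pullbackPushforwardAdj π).homEquiv W ((Over.star Ut).obj Z)
  -- Up to the comparison `i` of pullbacks, `uncurry` is transposition followed by the projection to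
  -- `Z`.
  have key (c : W ⟶ (polyOver π).obj Z) :
      uncurry sq c.left (Over.w c) = i.inv ≫ (e.symm c).left ≫ prod.snd := by
    have he : e.symm c = (ChosenPullbacksAlong.pullback π).map c ≫
        (ExponentiableMorphism.ev π).app ((Over.star Ut).obj Z) :=
      Adjunction.homEquiv_counit _ _ _ _
    have he' : (e.symm c).left ≫ prod.snd =
        ((ChosenPullbacksAlong.pullback π).map c).left ≫ genEval π Z := by
      rw [he]; exact Category.assoc _ _ _
    rw [he']
    refine uncurry_unique sq _ _ (t := i.inv ≫ ((ChosenPullbacksAlong.pullback π).map c).left)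
      ?_ ?_ (Category.assoc _ _ _)
    · rw [Category.assoc, selMap_fst, ← hi1, Category.assoc, Iso.inv_hom_id_assoc]
    · rw [Category.assoc, selMap_snd, ← hi2, Iso.inv_hom_id_assoc]
  have fst_eq (l : (ChosenPullbacksAlong.pullback π).obj W ⟶ (Over.star Ut).obj Z) :
      l.left ≫ prod.fst = selSnd π W := by
    rw [← star_obj_hom]; exact Over.w l
  let l : (ChosenPullbacksAlong.pullback π).obj W ⟶ (Over.star Ut).obj Z :=
    Over.homMk (prod.lift (selSnd π W) (i.hom ≫ f)) (by
      rw [star_obj_hom]; exact prod.lift_fst _ _)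
  have hl : l.left ≫ prod.snd = i.hom ≫ f := prod.lift_snd _ _
  refine ⟨(e l).left, ⟨Over.w (e l), ?_⟩, ?_⟩
  · rw [key (e l), Equiv.symm_apply_apply, hl, Iso.inv_hom_id_assoc]
  · rintro c ⟨hc, hf⟩
    have h := key (Over.homMk c hc)
    have : e.symm (Over.homMk c hc) = l := by
      ext
      -- The component in `Ut` is forced, being the structure map over `Ut`; only the component in
      -- `Z` carries information.
      apply prod.hom_ext
      · exact (fst_eq _).trans (fst_eq _).symm
      · refine Eq.trans ?_ hl.symm
        rw [← hf]
        exact ((Iso.eq_inv_comp i).1 h).symm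
    exact congrArg CommaMorphism.left ((Equiv.symm_apply_eq e).1 this)

/-- The map `Γ ⟶ P_π(Z)` naming a map `D ⟶ Z`, for `D ⟶ Γ` a pullback of `π`. -/
def curry {Γ D Z : C} {k : D ⟶ Ut} {p : D ⟶ Γ} {a : Γ ⟶ U} (sq : IsPullback k p π a)
    (f : D ⟶ Z) : Γ ⟶ polyObj π Z :=
  (existsUnique_uncurry sq f).choose

section

variable {Γ D Z : C} {k : D ⟶ Ut} {p : D ⟶ Γ} {a : Γ ⟶ U} (sq : IsPullback k p π a)

theorem curry_name (f : D ⟶ Z) : curry sq f ≫ polyName π Z = a :=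
  (existsUnique_uncurry sq f).choose_spec.1.1

theorem uncurry_curry (f : D ⟶ Z) : uncurry sq (curry sq f) (curry_name sq f) = f :=
  (existsUnique_uncurry sq f).choose_spec.1.2

theorem eq_curry {f : D ⟶ Z} (c : Γ ⟶ polyObj π Z) (hc : c ≫ polyName π Z = a)
    (h : uncurry sq c hc = f) : c = curry sq f :=
  (existsUnique_uncurry sq f).choose_spec.2 c ⟨hc, h⟩

theorem curry_uncurry (c : Γ ⟶ polyObj π Z) (hc : c ≫ polyName π Z = a) :
    curry sq (uncurry sq c hc) = c :=
  (eq_curry sq c hc rfl).symm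

theorem uncurry_injective {c c' : Γ ⟶ polyObj π Z} (hc : c ≫ polyName π Z = a)
    (hc' : c' ≫ polyName π Z = a) (h : uncurry sq c hc = uncurry sq c' hc') : c = c' :=
  (eq_curry sq c hc h).trans (curry_uncurry sq c' hc')

theorem comp_curry {Γ' D' : C} {k' : D' ⟶ Ut} {p' : D' ⟶ Γ'} {a' : Γ' ⟶ U}
    (sq' : IsPullback k' p' π a') {γ : Γ' ⟶ Γ} {δ : D' ⟶ D} (hk : δ ≫ k = k')
    (hp : δ ≫ p = p' ≫ γ) (ha : γ ≫ a = a') (f : D ⟶ Z) :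
    γ ≫ curry sq f = curry sq' (δ ≫ f) :=
  eq_curry _ _ (by rw [Category.assoc, curry_name, ha])
    (by rw [uncurry_comp sq sq' hk hp _ (curry_name sq f), uncurry_curry])

theorem curry_map {Z' : C} (f : D ⟶ Z) (z : Z ⟶ Z') :
    curry sq f ≫ polyMap π z = curry sq (f ≫ z) :=
  eq_curry _ _ (by rw [Category.assoc, polyMap_name, curry_name])
    (by rw [uncurry_map sq _ (curry_name sq f), uncurry_curry])

end

end Curry

/-! ### Restriction of a family to the generic fibration -/

section Restriction

variable {Ut U : C} (π : Ut ⟶ U) [ChosenPullbacksAlong π] [ExponentiableMorphism π]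

/-- Pasting with the selected pullback exhibits the base change of the generic fibration to `T` as a
pullback of `π`, so that `curry` and `uncurry` apply over `T`. -/
theorem isPullback_genTotal (T : Over (genBase π)) :
    IsPullback (pullback.snd T.hom (genFib π) ≫ selSnd π ((polyOver π).obj U))
      (pullback.fst T.hom (genFib π)) π (T.hom ≫ genName π) :=
  ((IsPullback.of_hasPullback T.hom (genFib π)).paste_vert (isPullback_sel π _)).flip

variable {π} in
theorem left_polyName {T : Over (genBase π)} {Z : Over U} (k : T ⟶ Over.mk (genMap π Z)) :
    k.left ≫ polyName π Z.left = T.hom ≫ genName π := by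
  have h : k.left ≫ genMap π Z = T.hom := Over.w k
  rw [← h, Category.assoc, genMap_name]

/-- The map over `ev` classified by a map into `P_π(Z)` over `P_π(U)`. -/
theorem uncurry_genTotal {T : Over (genBase π)} {Z : Over U} (k : T ⟶ Over.mk (genMap π Z)) :
    uncurry (isPullback_genTotal π T) k.left (left_polyName k) =
      ((Over.pullback (genFib π)).map k ≫ genTranspose π Z).left ≫
        pullback.fst Z.hom (genEval π U) := by
  have h1 : ((Over.pullback (genFib π)).map k).left ≫ pullback.fst (genMap π Z) (genFib π) =
      pullback.fst T.hom (genFib π) ≫ k.left := pullback.lift_fst _ _ _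
  have h2 : ((Over.pullback (genFib π)).map k).left ≫ pullback.snd (genMap π Z) (genFib π) =
      pullback.snd T.hom (genFib π) := pullback.lift_snd _ _ _
  have h3 : (genTranspose π Z).left ≫ pullback.fst Z.hom (genEval π U) =
      genProj π Z ≫ genEval π Z.left := pullback.lift_fst _ _ _
  refine uncurry_unique _ _ _ (t := ((Over.pullback (genFib π)).map k).left ≫ genProj π Z)
    ?_ ?_ ?_
  · rw [Category.assoc, genProj_fst, h1]
  · rw [Category.assoc, genProj_snd, reassoc_of% h2]
  · rw [Over.comp_left, Category.assoc, Category.assoc]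
    exact congrArg (_ ≫ ·) h3.symm

/-- Maps over `P_π(U)` into `P_π(Z)` correspond to maps over `π^* P_π(U)` into `ev^* Z`. -/
theorem genTranspose_bijective (T : Over (genBase π)) (Z : Over U) :
    Function.Bijective fun k : T ⟶ Over.mk (genMap π Z) =>
      (Over.pullback (genFib π)).map k ≫ genTranspose π Z := by
  constructor
  · intro k l h
    ext
    refine uncurry_injective (isPullback_genTotal π T) (left_polyName k) (left_polyName l) ?_
    rw [uncurry_genTotal, uncurry_genTotal]
    exact congrArg (fun m => m.left ≫ pullback.fst Z.hom (genEval π U)) h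
  · intro m
    have hm : m.left ≫ pullback.snd Z.hom (genEval π U) = pullback.snd T.hom (genFib π) := Over.w m
    let c := curry (isPullback_genTotal π T) (m.left ≫ pullback.fst Z.hom (genEval π U))
    -- As a map into `P_π(U)`, the structure map of `T` names evaluation; hence a `c` naming a lift
    -- of evaluation to `Z` lies over `P_π(U)`.
    have hU : uncurry (isPullback_genTotal π T) T.hom rfl =
        pullback.snd T.hom (genFib π) ≫ genEval π U :=
      uncurry_unique _ _ _ pullback.condition.symm rfl rfl
    have hc : c ≫ genMap π Z = T.hom := by
      refine (curry_map _ _ _).trans (Eq.symm (eq_curry _ _ rfl (hU.trans ?_)))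
      rw [Category.assoc, pullback.condition, reassoc_of% hm]
    refine ⟨Over.homMk c hc, ?_⟩
    ext
    refine pullback.hom_ext ?_ ?_
    · refine (uncurry_genTotal π (Over.homMk c hc : T ⟶ Over.mk (genMap π Z))).symm.trans ?_
      exact uncurry_curry (isPullback_genTotal π T) _
    · exact (Over.w _).trans (Over.w m).symm

/-- By Yoneda: composition with `genCompare` is the bijection `genTranspose_bijective` followed by
transposition along `q^* ⊣ q_*`. -/
instance isIso_genCompare (Z : Over U) : IsIso (genCompare π Z) := by
  rw [isIso_iff_yoneda_map_bijective]
  intro T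
  have h : (fun k : T ⟶ Over.mk (genMap π Z) => k ≫ genCompare π Z) =
      (pushforwardAdj (genFib π) (genFibrancy π).isFibration).homEquiv T _ ∘
        fun k => (Over.pullback (genFib π)).map k ≫ genTranspose π Z := by
    funext k
    exact (Adjunction.homEquiv_naturality_left _ _ _).symm
  rw [h]
  exact (Equiv.bijective _).comp (genTranspose_bijective π T Z)

/-- Once `q_* (ev^* Z)` is replaced by `P_π(Z)`, the factor `P_π(U)` cancels from the iterated
pullback, since `P_π(Z) ⟶ U` factors through it. -/
instance isIso_genSplit (X Z : Over U) : IsIso (genSplit π X Z) := by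
  have hc1 : (genCompare π Z).left ≫ (inv (genCompare π Z)).left = 𝟙 _ := by
    rw [← Over.comp_left, IsIso.hom_inv_id, Over.id_left]
  have hc2 : (inv (genCompare π Z)).left ≫ (genCompare π Z).left = 𝟙 _ := by
    rw [← Over.comp_left, IsIso.inv_hom_id, Over.id_left]
  have hw : (inv (genCompare π Z)).left ≫ genMap π Z = _ := Over.w (inv (genCompare π Z))
  have hX : ((Over.pullback (genName π)).obj X).hom = pullback.snd X.hom (genName π) := rfl
  let i : pullback ((Over.pullback (genName π)).obj X).hom
      ((pushforward (genFib π) (genFibrancy π).isFibration).obj ((genPull π).obj Z)).hom ⟶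
      pullback X.hom ((polyOver π).obj Z.left).hom :=
    pullback.lift (pullback.fst _ _ ≫ pullback.fst X.hom (genName π))
      (pullback.snd _ _ ≫ (inv (genCompare π Z)).left) (by
        rw [Category.assoc, Category.assoc, ← genMap_name, reassoc_of% hw, pullback.condition,
          ← hX, pullback.condition_assoc])
  have hi1 : i ≫ pullback.fst _ _ = _ := pullback.lift_fst _ _ _
  have hi2 : i ≫ pullback.snd _ _ = _ := pullback.lift_snd _ _ _
  have hs1 : genSplitBase π X Z ≫ pullback.fst _ _ = _ := pullback.lift_fst _ _ _
  have hs2 : genSplitBase π X Z ≫ pullback.snd _ _ = _ := pullback.lift_snd _ _ _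
  refine ⟨i, ?_, ?_⟩
  · apply pullback.hom_ext
    · rw [Category.assoc, hi1, ← Category.assoc, genSplit_fst]
      exact hs1.trans (Category.id_comp _).symm
    · rw [Category.assoc, hi2, ← Category.assoc, genSplit_snd, Category.assoc, hc1]
      exact (Category.comp_id _).trans (Category.id_comp _).symm
  · apply pullback.hom_ext
    · rw [Category.assoc, genSplit_fst, Category.id_comp]
      apply pullback.hom_ext
      · rw [Category.assoc, hs1, hi1]
      · rw [Category.assoc, hs2, reassoc_of% hi2, hw]
        exact pullback.condition.symm
    · rw [Category.assoc, genSplit_snd, reassoc_of% hi2, hc2]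
      exact (Category.comp_id _).trans (Category.id_comp _).symm

/-- Naturality in the test object, which turns uniformity over `P_π(U)` into uniformity over `U`. -/
theorem genSplit_testMap {X' X : Over U} (t : X' ⟶ X) (Z : Over U) :
    testMap t ((polyOver π).obj Z.left) ≫ genSplit π X Z =
      genSplit π X' Z ≫ testMap ((Over.pullback (genName π)).map t) _ := by
  have h1 : ((Over.pullback (genName π)).map t).left ≫ pullback.fst _ _ = _ :=
    pullback.lift_fst _ _ _
  have h2 : ((Over.pullback (genName π)).map t).left ≫ pullback.snd _ _ = _ :=
    pullback.lift_snd _ _ _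
  apply pullback.hom_ext
  · rw [Category.assoc, Category.assoc, genSplit_fst, testMap_fst, ← Category.assoc,
      genSplit_fst]
    apply pullback.hom_ext
    · rw [Category.assoc, Category.assoc, h1, genSplitBase, genSplitBase, pullback.lift_fst,
        pullback.lift_fst_assoc, testMap_fst]
    · rw [Category.assoc, Category.assoc, h2, genSplitBase, genSplitBase, pullback.lift_snd,
        pullback.lift_snd, ← Category.assoc, testMap_snd]
  · rw [Category.assoc, Category.assoc, genSplit_snd, testMap_snd, genSplit_snd,
      ← Category.assoc, testMap_snd]

variable {π}

/-- Transports a lifting problem over `U` to one that `PushforwardFamily.atRefl` solves. -/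
theorem inv_genSplit_comm {X : Over U} {Z Z' : Over U} (k : Z ⟶ Z')
    {u : pullback X.hom ((polyOver π).obj Z.left).hom ⟶ Ut}
    {v : pullback X.hom ((polyOver π).obj Z'.left).hom ⟶ U}
    (w : u ≫ π = baseMap X ((polyOver π).map k.left) ≫ v) :
    (inv (genSplit π X Z) ≫ u) ≫ π = baseMap ((Over.pullback (genName π)).obj X)
      ((pushforward (genFib π) (genFibrancy π).isFibration).map ((genPull π).map k)) ≫
        inv (genSplit π X Z') ≫ v := by
  rw [← cancel_epi (genSplit π X Z), Category.assoc, IsIso.hom_inv_id_assoc, w,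
    ← Category.assoc (genSplit π X Z), genSplit_naturality, Category.assoc,
    IsIso.hom_inv_id_assoc]

theorem inv_genSplit_testMap {X' X : Over U} (t : X' ⟶ X) (Z : Over U) {W : C}
    (u : pullback X.hom ((polyOver π).obj Z.left).hom ⟶ W) :
    inv (genSplit π X' Z) ≫ testMap t ((polyOver π).obj Z.left) ≫ u =
      testMap ((Over.pullback (genName π)).map t) _ ≫ inv (genSplit π X Z) ≫ u := by
  rw [IsIso.inv_comp_eq, ← Category.assoc (genSplit π X' Z), ← genSplit_testMap,
    Category.assoc, IsIso.hom_inv_id_assoc]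

/-- The pointed functional extensionality structure obtained by restricting a family to the
generic case. -/
def PushforwardFamily.restrict (φ : PushforwardFamily π) (I : IdStructure π)
    (σ : FibrancyStructure π I.idOver.hom) : PtdFunExt I where
  lift X u v w := genSplit π X I.idOver ≫
    (φ.atRefl I σ).lift ((Over.pullback (genName π)).obj X)
      (inv (genSplit π X (Over.mk π)) ≫ u) (inv (genSplit π X I.idOver) ≫ v)
      (inv_genSplit_comm I.refl w)
  upper X u v w := by
    refine (Category.assoc _ _ _).symm.trans ?_
    refine (congrArg (· ≫ _) (genSplit_naturality π X I.refl).symm).trans ?_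
    refine (Category.assoc _ _ _).trans ?_
    refine (congrArg _ ((φ.atRefl I σ).upper _ _ _ (inv_genSplit_comm I.refl w))).trans ?_
    exact IsIso.hom_inv_id_assoc _ _
  lower X u v w := by
    rw [Category.assoc, LiftingStructure.lower, IsIso.hom_inv_id_assoc]
  uniform {X' X} t u v w := by
    have h := (φ.atRefl I σ).uniform ((Over.pullback (genName π)).map t) _ _
      (inv_genSplit_comm I.refl w)
    refine Eq.trans ?_ ((congrArg (genSplit π X' I.idOver ≫ ·) h).trans ?_)
    · congr 2
      · exact inv_genSplit_testMap t _ u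
      · exact inv_genSplit_testMap t _ v
    · rw [← Category.assoc, ← genSplit_testMap, Category.assoc]

theorem PushforwardFamily.restrictsTo_restrict (φ : PushforwardFamily π) (I : IdStructure π)
    (σ : FibrancyStructure π I.idOver.hom) : φ.RestrictsTo I σ (φ.restrict I σ) := by
  intro X u v w
  dsimp only [PushforwardFamily.restrict]
  congr 2
  · rw [IsIso.inv_hom_id_assoc]
  · rw [IsIso.inv_hom_id_assoc]

end Restriction

/-! ### Function types -/

section Hom

variable {Ut U : C} {π : Ut ⟶ U} [ChosenPullbacksAlong π] [ExponentiableMorphism π]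

/-- The dependent product `P_π(U) ⟶ U`. -/
def piName (P : PiStructure π) : polyObj π U ⟶ U := P.name

/-- Abstraction `P_π(Ut) ⟶ Ut`. -/
def piPoint (P : PiStructure π) : polyObj π Ut ⟶ Ut := P.point

theorem isPullback_pi (P : PiStructure π) :
    IsPullback (piPoint P) (polyMap π π) π (piName P) := P.isPullback

variable (P : PiStructure π) {Γ : C}

/-- The name `Γ ⟶ P_π(U)` of the constant family `b` over `a`. -/
def constName (a b : Γ ⟶ U) : Γ ⟶ polyObj π U :=
  curry (IsPullback.of_hasPullback a π).flip (pullback.fst a π ≫ b)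

/-- The name of the type of functions from `a` to `b`. -/
def homName (a b : Γ ⟶ U) : Γ ⟶ U := constName a b ≫ piName P

/-- The identity function of `a`. -/
def idHom (a : Γ ⟶ U) : Γ ⟶ Ut :=
  curry (IsPullback.of_hasPullback a π).flip (pullback.snd a π) ≫ piPoint P

/-- The map `a^* Ut ⟶ Ut` over base change. -/
abbrev baseChangeMap {Γ' : C} (γ : Γ' ⟶ Γ) (a : Γ ⟶ U) : pullback (γ ≫ a) π ⟶ pullback a π :=
  pullback.lift (pullback.fst _ _ ≫ γ) (pullback.snd _ _)
    (by rw [Category.assoc, pullback.condition])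

theorem comp_constName {Γ' : C} (γ : Γ' ⟶ Γ) (a b : Γ ⟶ U) :
    γ ≫ constName (π := π) a b = constName (γ ≫ a) (γ ≫ b) := by
  rw [constName, comp_curry (IsPullback.of_hasPullback a π).flip
    (IsPullback.of_hasPullback (γ ≫ a) π).flip (δ := baseChangeMap γ a)
    (pullback.lift_snd _ _ _) (pullback.lift_fst _ _ _) rfl, constName,
    pullback.lift_fst_assoc, Category.assoc]

/-- Function types commute strictly with substitution because classifying maps into `P_π(U)` are
unique. The uniformity of `J` can only be applied to motives that are stable on the nose. -/
theorem comp_homName {Γ' : C} (γ : Γ' ⟶ Γ) (a b : Γ ⟶ U) :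
    γ ≫ homName P a b = homName P (γ ≫ a) (γ ≫ b) := by
  rw [homName, ← Category.assoc, comp_constName, homName]

theorem comp_idHom {Γ' : C} (γ : Γ' ⟶ Γ) (a : Γ ⟶ U) :
    γ ≫ idHom P a = idHom P (γ ≫ a) := by
  rw [idHom, ← Category.assoc, comp_curry (IsPullback.of_hasPullback a π).flip
    (IsPullback.of_hasPullback (γ ≫ a) π).flip (δ := baseChangeMap γ a)
    (pullback.lift_snd _ _ _) (pullback.lift_fst _ _ _) rfl, idHom, pullback.lift_snd]

theorem curry_snd_polyMap (a : Γ ⟶ U) :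
    curry (IsPullback.of_hasPullback a π).flip (pullback.snd a π) ≫ polyMap π π =
      constName a a := by
  rw [curry_map, constName, pullback.condition]

theorem idHom_comp (a : Γ ⟶ U) : idHom P a ≫ π = homName P a a := by
  rw [idHom, Category.assoc, (isPullback_pi P).w, ← Category.assoc, curry_snd_polyMap, homName]

variable {P} {a b : Γ ⟶ U} {m t : Γ ⟶ Ut}

/-- The map `Γ ⟶ P_π(Ut)` corresponding to a function. -/
def unabs (hm : m ≫ π = homName P a b) : Γ ⟶ polyObj π Ut :=
  (isPullback_pi P).lift m (constName a b) hm

theorem unabs_point (hm : m ≫ π = homName P a b) : unabs hm ≫ piPoint P = m :=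
  IsPullback.lift_fst _ _ _ _

theorem unabs_polyMap (hm : m ≫ π = homName P a b) : unabs hm ≫ polyMap π π = constName a b :=
  IsPullback.lift_snd _ _ _ _

theorem unabs_name (hm : m ≫ π = homName P a b) : unabs hm ≫ polyName π Ut = a := by
  rw [← polyMap_name π π, ← Category.assoc, unabs_polyMap, constName, curry_name]

theorem comp_unabs {Γ' : C} (γ : Γ' ⟶ Γ) (hm : m ≫ π = homName P a b)
    (hm' : (γ ≫ m) ≫ π = homName P (γ ≫ a) (γ ≫ b)) : γ ≫ unabs hm = unabs hm' := by
  apply (isPullback_pi P).hom_ext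
  · rw [Category.assoc, unabs_point, unabs_point]
  · rw [Category.assoc, unabs_polyMap, unabs_polyMap, comp_constName]

/-- The point of `a^* Ut` determined by an element `t` of `a`. -/
abbrev elem (ht : t ≫ π = a) : Γ ⟶ pullback a π :=
  pullback.lift (𝟙 Γ) t (by rw [Category.id_comp, ht])

/-- Application of a function from `a` to `b` to an element of `a`. -/
def app (hm : m ≫ π = homName P a b) (ht : t ≫ π = a) : Γ ⟶ Ut :=
  elem ht ≫ uncurry (IsPullback.of_hasPullback a π).flip (unabs hm) (unabs_name hm)

/-- Uncurrying commutes with postcomposition by `π`, and the family below a function from `a` to `b`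
is the constant one at `b`. -/
theorem app_comp (hm : m ≫ π = homName P a b) (ht : t ≫ π = a) : app hm ht ≫ π = b := by
  have h : (unabs hm ≫ polyMap π π) ≫ polyName π U = a := by
    rw [Category.assoc, polyMap_name, unabs_name]
  rw [app, Category.assoc, ← uncurry_map _ _ _ _ h]
  simp only [unabs_polyMap, constName]
  rw [uncurry_curry, pullback.lift_fst_assoc, Category.id_comp]

theorem comp_app {Γ' : C} (γ : Γ' ⟶ Γ) (hm : m ≫ π = homName P a b) (ht : t ≫ π = a)
    (hm' : (γ ≫ m) ≫ π = homName P (γ ≫ a) (γ ≫ b)) (ht' : (γ ≫ t) ≫ π = γ ≫ a) :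
    γ ≫ app hm ht = app hm' ht' := by
  have h := uncurry_comp (IsPullback.of_hasPullback a π).flip
    (IsPullback.of_hasPullback (γ ≫ a) π).flip (δ := baseChangeMap γ a)
    (pullback.lift_snd _ _ _) (pullback.lift_fst _ _ _) (unabs hm) (unabs_name hm)
    (by rw [Category.assoc, unabs_name])
  simp only [comp_unabs γ hm hm'] at h
  rw [app, app, h, ← Category.assoc, ← Category.assoc]
  congr 1
  apply pullback.hom_ext
  · rw [Category.assoc, Category.assoc, pullback.lift_fst, pullback.lift_fst,
      pullback.lift_fst_assoc, Category.id_comp, Category.comp_id]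
  · rw [Category.assoc, Category.assoc, pullback.lift_snd, pullback.lift_snd, pullback.lift_snd]

/-- The strict computation rule: in the pullback defining `Π`, the abstraction `idHom` can only come
from the generic element of `a`. -/
theorem app_idHom (hm : idHom P a ≫ π = homName P a a) (ht : t ≫ π = a) : app hm ht = t := by
  have h : unabs hm = curry (IsPullback.of_hasPullback a π).flip (pullback.snd a π) := by
    apply (isPullback_pi P).hom_ext
    · rw [unabs_point, idHom]
    · rw [unabs_polyMap, curry_snd_polyMap]
  rw [app]
  simp only [h]
  rw [uncurry_curry, pullback.lift_snd]

theorem app_congr {a' b' : Γ ⟶ U} {m' t' : Γ ⟶ Ut} (hm : m ≫ π = homName P a b)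
    (ht : t ≫ π = a) (hm' : m' ≫ π = homName P a' b') (ht' : t' ≫ π = a') (ea : a = a')
    (eb : b = b') (em : m = m') (et : t = t') : app hm ht = app hm' ht' := by
  subst ea eb em et
  rfl

end Hom

/-! ### Transport -/

section Transport

variable {Ut U : C} {π : Ut ⟶ U} [ChosenPullbacksAlong π]

namespace PreIdStructure

variable (I : PreIdStructure π)

/-- The pair of end points of an identification. -/
def idPair : I.idOver.left ⟶ pullback π π := ChosenPullbacksAlong.fst I.Id π

/-- The underlying element of an identification. -/
def idPoint : I.idOver.left ⟶ Ut := ChosenPullbacksAlong.snd I.Id π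

/-- The source of an identification. -/
def src : I.idOver.left ⟶ Ut := I.idPair ≫ pullback.fst π π

/-- The target of an identification. -/
def tgt : I.idOver.left ⟶ Ut := I.idPair ≫ pullback.snd π π

theorem src_comp : I.src ≫ π = I.idOver.hom := Category.assoc _ _ _

theorem tgt_comp : I.tgt ≫ π = I.idOver.hom := by
  rw [← src_comp, tgt, src, Category.assoc, Category.assoc, pullback.condition]

theorem refl_pair : I.refl.left ≫ I.idPair = pullback.diagonal π :=
  ChosenPullbacksAlong.lift_fst _ _ I.comm.symm

theorem refl_point : I.refl.left ≫ I.idPoint = I.reflPoint :=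
  ChosenPullbacksAlong.lift_snd _ _ I.comm.symm

theorem refl_src : I.refl.left ≫ I.src = 𝟙 Ut := by
  rw [src, ← Category.assoc, refl_pair, pullback.diagonal_fst]
  rfl

theorem refl_tgt : I.refl.left ≫ I.tgt = 𝟙 Ut := by
  rw [tgt, ← Category.assoc, refl_pair, pullback.diagonal_snd]
  rfl

variable {Z : C}

variable {I} in
-- `Id_U(Ut)` is a pullback of `π` over `Ut ×_U Ut`, so a map into it consists of two end points and
-- an underlying element.
theorem id_hom_ext {f g : Z ⟶ I.idOver.left} (h₁ : f ≫ I.src = g ≫ I.src)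
    (h₂ : f ≫ I.tgt = g ≫ I.tgt) (h₃ : f ≫ I.idPoint = g ≫ I.idPoint) : f = g := by
  refine ChosenPullbacksAlong.hom_ext I.Id π ?_ h₃
  apply pullback.hom_ext
  · exact (Category.assoc _ _ _).trans (h₁.trans (Category.assoc _ _ _).symm)
  · exact (Category.assoc _ _ _).trans (h₂.trans (Category.assoc _ _ _).symm)

variable {x y : Z ⟶ Ut} (hxy : x ≫ π = y ≫ π) (e : Z ⟶ Ut)
  (he : e ≫ π = pullback.lift x y hxy ≫ I.Id)

/-- The map into `Id_U(Ut)` determined by an identification of `x` with `y`. -/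
def idLift : Z ⟶ I.idOver.left :=
  ChosenPullbacksAlong.lift (pullback.lift x y hxy) e he.symm

theorem idLift_pair : I.idLift hxy e he ≫ I.idPair = pullback.lift x y hxy :=
  ChosenPullbacksAlong.lift_fst _ _ he.symm

theorem idLift_point : I.idLift hxy e he ≫ I.idPoint = e :=
  ChosenPullbacksAlong.lift_snd _ _ he.symm

theorem idLift_src : I.idLift hxy e he ≫ I.src = x := by
  rw [src, ← Category.assoc, idLift_pair, pullback.lift_fst]

theorem idLift_tgt : I.idLift hxy e he ≫ I.tgt = y := by
  rw [tgt, ← Category.assoc, idLift_pair, pullback.lift_snd]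

/-- The source map `X ×_U Id_U(Ut) ⟶ X ×_U Ut`. -/
def srcMap (X : Over U) : pullback X.hom I.idOver.hom ⟶ pullback X.hom (Over.mk π).hom :=
  baseMap X (Over.homMk I.src I.src_comp : I.idOver ⟶ Over.mk π)

/-- The target map `X ×_U Id_U(Ut) ⟶ X ×_U Ut`. -/
def tgtMap (X : Over U) : pullback X.hom I.idOver.hom ⟶ pullback X.hom (Over.mk π).hom :=
  baseMap X (Over.homMk I.tgt I.tgt_comp : I.idOver ⟶ Over.mk π)

theorem srcMap_fst (X : Over U) : I.srcMap X ≫ pullback.fst X.hom (Over.mk π).hom =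
    pullback.fst X.hom I.idOver.hom := baseMap_fst _ _

theorem srcMap_snd (X : Over U) : I.srcMap X ≫ pullback.snd X.hom (Over.mk π).hom =
    pullback.snd X.hom I.idOver.hom ≫ I.src := baseMap_snd _ _

theorem tgtMap_fst (X : Over U) : I.tgtMap X ≫ pullback.fst X.hom (Over.mk π).hom =
    pullback.fst X.hom I.idOver.hom := baseMap_fst _ _

theorem tgtMap_snd (X : Over U) : I.tgtMap X ≫ pullback.snd X.hom (Over.mk π).hom =
    pullback.snd X.hom I.idOver.hom ≫ I.tgt := baseMap_snd _ _

theorem reflMap_srcMap (X : Over U) : baseMap X I.refl ≫ I.srcMap X = 𝟙 _ := by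
  apply pullback.hom_ext
  · rw [Category.assoc, srcMap_fst, baseMap_fst, Category.id_comp]
  · rw [Category.assoc, srcMap_snd, ← Category.assoc, baseMap_snd, Category.assoc, refl_src]
    exact (Category.comp_id _).trans (Category.id_comp _).symm

theorem reflMap_tgtMap (X : Over U) : baseMap X I.refl ≫ I.tgtMap X = 𝟙 _ := by
  apply pullback.hom_ext
  · rw [Category.assoc, tgtMap_fst, baseMap_fst, Category.id_comp]
  · rw [Category.assoc, tgtMap_snd, ← Category.assoc, baseMap_snd, Category.assoc, refl_tgt]
    exact (Category.comp_id _).trans (Category.id_comp _).symm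

theorem testMap_srcMap {X' X : Over U} (k : X' ⟶ X) :
    testMap k I.idOver ≫ I.srcMap X = I.srcMap X' ≫ testMap k (Over.mk π) :=
  testMap_baseMap _ _

theorem testMap_tgtMap {X' X : Over U} (k : X' ⟶ X) :
    testMap k I.idOver ≫ I.tgtMap X = I.tgtMap X' ≫ testMap k (Over.mk π) :=
  testMap_baseMap _ _

end PreIdStructure

namespace IdStructure

variable [ExponentiableMorphism π] (P : PiStructure π) (I : IdStructure π) {X : Over U}
  (T : pullback X.hom (Over.mk π).hom ⟶ U)

/-- The name over `X ×_U Id_U(Ut)` of the type of functions from `T` at the source to `T` at the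
target. -/
abbrev transportName : pullback X.hom I.idOver.hom ⟶ U :=
  homName P (I.srcMap X ≫ T) (I.tgtMap X ≫ T)

/-- The lifting problem for `J`: on reflexivity both end points are the same, so the motive becomes
functions from `T` to itself. A function type is needed as motive because the element to be
transported lives over a further context `Z`, while `J` only sees `X ×_U refl`. -/
theorem idHom_transportName :
    idHom P T ≫ π = baseMap X I.refl ≫ I.transportName P T := by
  rw [idHom_comp, comp_homName, ← Category.assoc, ← Category.assoc, I.reflMap_srcMap,
    I.reflMap_tgtMap, Category.id_comp]

/-- The transport function of the family `T`, by `J`-elimination. -/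
def transportHom : pullback X.hom I.idOver.hom ⟶ Ut :=
  I.J.lift X (idHom P T) (I.transportName P T) (I.idHom_transportName P T)

theorem transportHom_comp : I.transportHom P T ≫ π = I.transportName P T :=
  I.J.lower _ _ _ _

theorem reflMap_transportHom : baseMap X I.refl ≫ I.transportHom P T = idHom P T :=
  I.J.upper _ _ _ _

/-- Uniformity of `J`, applicable since both the motive and the identity function are stable under
substitution. -/
theorem testMap_transportHom {X' : Over U} (k : X' ⟶ X) :
    testMap k I.idOver ≫ I.transportHom P T =
      I.transportHom P (testMap k (Over.mk π) ≫ T) := by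
  rw [transportHom, ← I.J.uniform k, transportHom]
  congr 1
  · exact comp_idHom P _ _
  · rw [comp_homName, ← Category.assoc, ← Category.assoc, I.testMap_srcMap, I.testMap_tgtMap,
      Category.assoc, Category.assoc]

variable {Z : C} (p : Z ⟶ pullback X.hom I.idOver.hom)

theorem comp_transportHom_comp : (p ≫ I.transportHom P T) ≫ π =
    homName P (p ≫ I.srcMap X ≫ T) (p ≫ I.tgtMap X ≫ T) := by
  rw [Category.assoc, transportHom_comp, comp_homName]

variable {T p} {t : Z ⟶ Ut} (ht : t ≫ π = p ≫ I.srcMap X ≫ T)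

/-- The transport of an element `t` of `T` along an identification. -/
def transport : Z ⟶ Ut := app (I.comp_transportHom_comp P T p) ht

theorem transport_comp : I.transport P ht ≫ π = p ≫ I.tgtMap X ≫ T := app_comp _ _

theorem comp_transport {Z' : C} (c : Z' ⟶ Z)
    (ht' : (c ≫ t) ≫ π = (c ≫ p) ≫ I.srcMap X ≫ T) :
    c ≫ I.transport P ht = I.transport P ht' := by
  rw [transport, comp_app c _ _
    (by rw [Category.assoc, comp_transportHom_comp, comp_homName])
    (by rw [Category.assoc, ht])]
  exact app_congr _ _ _ _ (Category.assoc _ _ _).symm (Category.assoc _ _ _).symm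
    (Category.assoc _ _ _).symm rfl

theorem transport_congr {p' : Z ⟶ pullback X.hom I.idOver.hom} {t' : Z ⟶ Ut}
    {T' : pullback X.hom (Over.mk π).hom ⟶ U} (ht' : t' ≫ π = p' ≫ I.srcMap X ≫ T')
    (hp : p = p') (e : t = t') (hT : T = T') : I.transport P ht = I.transport P ht' := by
  subst hp e hT
  rfl

/-- The lift given by `J` restricts strictly to the identity function on reflexivity, and applying
that function returns its argument. -/
theorem transport_refl {e : Z ⟶ pullback X.hom (Over.mk π).hom}
    (hp : p = e ≫ baseMap X I.refl) : I.transport P ht = t := by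
  subst hp
  have ht₁ : t ≫ π = e ≫ T := by
    rw [ht, Category.assoc, ← Category.assoc (baseMap X I.refl), I.reflMap_srcMap,
      Category.id_comp]
  rw [transport]
  refine (app_congr _ _ (idHom_comp P (e ≫ T)) ht₁ (ht.symm.trans ht₁) ?_ ?_ rfl).trans
    (app_idHom _ _)
  · rw [Category.assoc, ← Category.assoc (baseMap X I.refl), I.reflMap_tgtMap, Category.id_comp]
  · rw [Category.assoc, reflMap_transportHom, comp_idHom]

/-- Restricting the family along `k` or pushing the identification forward along `k` makes no
difference, by uniformity of `J`. -/
theorem transport_testMap {X' : Over U} (k : X' ⟶ X) {p : Z ⟶ pullback X'.hom I.idOver.hom}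
    (ht : t ≫ π = p ≫ I.srcMap X' ≫ testMap k (Over.mk π) ≫ T)
    (ht' : t ≫ π = (p ≫ testMap k I.idOver) ≫ I.srcMap X ≫ T) :
    I.transport P ht = I.transport P ht' := by
  refine app_congr _ _ _ _ (ht.symm.trans ht') ?_ ?_ rfl
  · rw [Category.assoc, ← Category.assoc (testMap k I.idOver), I.testMap_tgtMap, Category.assoc]
  · rw [Category.assoc, testMap_transportHom]

end IdStructure

end Transport

/-! ### Homotopy retractions -/

/-! ### Fillers for `s` itself, from the terminal test object -/

section Fill

variable {Ut U : C} {π : Ut ⟶ U} {B : C} {Y E : Over B} {s : Y ⟶ E}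

/-- The map `E ⟶ B ×_B E`. -/
def unitMap (E : Over B) : E.left ⟶ pullback (Over.mk (𝟙 B)).hom E.hom :=
  pullback.lift E.hom (𝟙 _) ((Category.comp_id _).trans (Category.id_comp _).symm)

theorem unitMap_fst (E : Over B) :
    unitMap E ≫ pullback.fst (Over.mk (𝟙 B)).hom E.hom = E.hom := pullback.lift_fst _ _ _

theorem unitMap_snd (E : Over B) :
    unitMap E ≫ pullback.snd (Over.mk (𝟙 B)).hom E.hom = 𝟙 _ := pullback.lift_snd _ _ _

theorem unitMap_baseMap (s : Y ⟶ E) :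
    unitMap Y ≫ baseMap (Over.mk (𝟙 B)) s = s.left ≫ unitMap E := by
  apply pullback.hom_ext
  · rw [Category.assoc, baseMap_fst, Category.assoc, unitMap_fst, unitMap_fst, Over.w]
  · rw [Category.assoc, baseMap_snd, Category.assoc, unitMap_snd, ← Category.assoc, unitMap_snd]
    exact (Category.id_comp _).trans (Category.comp_id _).symm

namespace LiftingStructure

variable (F : LiftingStructure π s) {u : Y.left ⟶ Ut} {v : E.left ⟶ U}

theorem fill_aux (w : u ≫ π = s.left ≫ v) :
    (pullback.snd (Over.mk (𝟙 B)).hom Y.hom ≫ u) ≫ π =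
      baseMap (Over.mk (𝟙 B)) s ≫ pullback.snd (Over.mk (𝟙 B)).hom E.hom ≫ v := by
  rw [← Category.assoc (baseMap _ _), baseMap_snd, Category.assoc, Category.assoc, w]

/-- The solution of a lifting problem of `s` itself. -/
def fill (w : u ≫ π = s.left ≫ v) : E.left ⟶ Ut :=
  unitMap E ≫ F.lift (Over.mk (𝟙 B)) _ _ (fill_aux w)

theorem comp_fill (w : u ≫ π = s.left ≫ v) : s.left ≫ F.fill w = u := by
  rw [fill, ← Category.assoc, ← unitMap_baseMap, Category.assoc, F.upper, ← Category.assoc,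
    unitMap_snd, Category.id_comp]

theorem fill_comp (w : u ≫ π = s.left ≫ v) : F.fill w ≫ π = v := by
  rw [fill, Category.assoc, F.lower, ← Category.assoc, unitMap_snd, Category.id_comp]

theorem fill_congr {u' : Y.left ⟶ Ut} {v' : E.left ⟶ U} (w : u ≫ π = s.left ≫ v)
    (w' : u' ≫ π = s.left ≫ v') (hu : u = u') (hv : v = v') : F.fill w = F.fill w' := by
  subst hu hv
  rfl

theorem lift_congr {X : Over B} {u u' : pullback X.hom Y.hom ⟶ Ut}
    {v v' : pullback X.hom E.hom ⟶ U} (w : u ≫ π = baseMap X s ≫ v)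
    (w' : u' ≫ π = baseMap X s ≫ v') (hu : u = u') (hv : v = v') :
    F.lift X u v w = F.lift X u' v' w' := by
  subst hu hv
  rfl

/-- Uniformity of `F` along `g`, seen as the map from `B'` to the terminal object of the slice over
`B`. -/
theorem fill_reindex {B' : C} {g : B' ⟶ B} {Y' E' : Over B'} {s' : Y' ⟶ E'}
    {cY : Y'.left ⟶ Y.left} {cE : E'.left ⟶ E.left}
    (hY : IsPullback cY Y'.hom Y.hom g) (hE : IsPullback cE E'.hom E.hom g)
    (hs : s'.left ≫ cE = cY ≫ s.left) (w : u ≫ π = s.left ≫ v)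
    (w' : (cY ≫ u) ≫ π = s'.left ≫ cE ≫ v) :
    (F.reindex s' hY hE hs).fill w' = cE ≫ F.fill w := by
  let k : (Over.map g).obj (Over.mk (𝟙 B')) ⟶ Over.mk (𝟙 B) :=
    Over.homMk g ((Category.comp_id _).trans (Category.id_comp _).symm)
  have hsnd {Z : Over B} {Z' : Over B'} {c : Z'.left ⟶ Z.left}
      (hc : IsPullback c Z'.hom Z.hom g) :
      pasteInv hc (Over.mk (𝟙 B')) ≫ pullback.snd (Over.mk (𝟙 B')).hom Z'.hom ≫ c =
        testMap k Z ≫ pullback.snd (Over.mk (𝟙 B)).hom Z.hom := by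
    rw [pasteInv_snd, testMap_snd]
  -- The graph of `E'` over `B'`, pasted and then sent to the terminal test object, is the graph of
  -- `E` restricted along `cE`.
  have hunit : unitMap E' ≫ pasteHom hE (Over.mk (𝟙 B')) ≫ testMap k E = cE ≫ unitMap E := by
    apply pullback.hom_ext
    · rw [Category.assoc, Category.assoc, Category.assoc, unitMap_fst, testMap_fst,
        ← Category.assoc (pasteHom _ _), pasteHom_fst, ← Category.assoc, unitMap_fst, hE.w]
      rfl
    · rw [Category.assoc, Category.assoc, Category.assoc, unitMap_snd, testMap_snd, pasteHom_snd,
        ← Category.assoc, unitMap_snd]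
      exact (Category.id_comp _).trans (Category.comp_id _).symm
  have h := F.uniform k _ _ (fill_aux w)
  rw [fill, fill, ← Category.assoc cE, ← hunit, Category.assoc, Category.assoc, ← h]
  refine congrArg (unitMap E' ≫ ·) (congrArg (pasteHom hE (Over.mk (𝟙 B')) ≫ ·)
    (F.lift_congr _ _ ?_ ?_))
  · rw [← Category.assoc (testMap _ _), ← hsnd hY, Category.assoc, Category.assoc]
  · rw [← Category.assoc (testMap _ _), ← hsnd hE, Category.assoc, Category.assoc]

end LiftingStructure

end Fill

/-! ### Strong deformation retractions for identity types, and their base change -/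

section Retract

variable {Ut U : C} {π : Ut ⟶ U} [ChosenPullbacksAlong π]

/-- A retraction `r` of `s` over the base together with a homotopy, constant on `s`, from `r ≫ s` to
the identity of an object with underlying elements `pt`. -/
structure HomotopyRetraction (I : PreIdStructure π) {B : C} {Y E : Over B} (s : Y ⟶ E)
    (pt : E.left ⟶ Ut) where
  r : E ⟶ Y
  h : E.left ⟶ I.idOver.left
  comp_r : s ≫ r = 𝟙 Y
  h_src : h ≫ I.src = r.left ≫ s.left ≫ pt
  h_tgt : h ≫ I.tgt = pt
  comp_h : s.left ≫ h = s.left ≫ pt ≫ I.refl.left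

/-- The homotopy retraction `D'` is a base change of `D`. -/
structure HomotopyRetraction.IsBaseChange {I : PreIdStructure π} {B B' : C} {Y E : Over B}
    {s : Y ⟶ E} {pt : E.left ⟶ Ut} {Y' E' : Over B'} {s' : Y' ⟶ E'} {pt' : E'.left ⟶ Ut}
    (D' : HomotopyRetraction I s' pt') (D : HomotopyRetraction I s pt)
    (cY : Y'.left ⟶ Y.left) (cE : E'.left ⟶ E.left) : Prop where
  r_comp : D'.r.left ≫ cY = cE ≫ D.r.left
  h_eq : D'.h = cE ≫ D.h

/-- The end points of a homotopy are determined by the retraction and the points of `E`, so only its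
underlying element needs comparing. -/
theorem HomotopyRetraction.isBaseChange_of_idPoint {I : PreIdStructure π} {B B' : C} {Y E : Over B}
    {s : Y ⟶ E} {pt : E.left ⟶ Ut} {Y' E' : Over B'} {s' : Y' ⟶ E'} {pt' : E'.left ⟶ Ut}
    {D' : HomotopyRetraction I s' pt'} {D : HomotopyRetraction I s pt}
    {cY : Y'.left ⟶ Y.left} {cE : E'.left ⟶ E.left} (hs : s'.left ≫ cE = cY ≫ s.left)
    (hpt : pt' = cE ≫ pt) (hr : D'.r.left ≫ cY = cE ≫ D.r.left)
    (h : D'.h ≫ I.idPoint = cE ≫ D.h ≫ I.idPoint) : D'.IsBaseChange D cY cE := by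
  subst hpt
  refine ⟨hr, PreIdStructure.id_hom_ext ?_ ?_ (h.trans (Category.assoc _ _ _).symm)⟩
  · rw [D'.h_src, Category.assoc, D.h_src, reassoc_of% hs, reassoc_of% hr]
  · rw [D'.h_tgt, Category.assoc, D.h_tgt]

/-! #### From lifting structures to homotopy retractions -/

namespace LiftingStructure

variable (I : PreIdStructure π) {B : C} {Y E : Over B} {s : Y ⟶ E} (F : LiftingStructure π s)
  (hY : FibrancyStructure π Y.hom) (hE : FibrancyStructure π E.hom)

/-- Fibrancy of `Y` makes extending the identity of `Y` along `s`, over `B`, a lifting problem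
against `π`. -/
theorem retraction_aux : hY.point ≫ π = s.left ≫ E.hom ≫ hY.name := by
  rw [hY.isPullback.w, ← Category.assoc, Over.w]

/-- The retraction of `s` obtained by lifting against the source of `s`. -/
def retraction : E ⟶ Y :=
  Over.homMk (hY.isPullback.lift (F.fill (retraction_aux hY)) E.hom (F.fill_comp _))
    (IsPullback.lift_snd _ _ _ _)

theorem retraction_point : (F.retraction hY).left ≫ hY.point = F.fill (retraction_aux hY) :=
  IsPullback.lift_fst _ _ _ _

theorem comp_retraction : s ≫ F.retraction hY = 𝟙 Y := by
  ext
  apply hY.isPullback.hom_ext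
  · rw [Over.comp_left, Category.assoc, retraction_point, comp_fill, Over.id_left,
      Category.id_comp]
  · rw [Over.w, Over.w]

theorem homotopy_w :
    ((F.retraction hY).left ≫ s.left ≫ hE.point) ≫ π = hE.point ≫ π := by
  rw [Category.assoc, Category.assoc, hE.isPullback.w, ← Category.assoc s.left, Over.w,
    ← Category.assoc, Over.w]

/-- The retraction is the identity on `s`, so along `s` the type of identifications of `r ≫ s` with
the identity has equal end points and contains reflexivity. -/
theorem homotopy_aux : (s.left ≫ hE.point ≫ I.reflPoint) ≫ π =
    s.left ≫ pullback.lift _ _ (F.homotopy_w hY hE) ≫ I.Id := by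
  have h : s.left ≫ (F.retraction hY).left = 𝟙 _ :=
    congrArg CommaMorphism.left (F.comp_retraction hY)
  rw [Category.assoc, Category.assoc, I.comm, ← Category.assoc, ← Category.assoc,
    ← Category.assoc s.left (pullback.lift _ _ _)]
  congr 1
  apply pullback.hom_ext
  · rw [Category.assoc, pullback.diagonal_fst, Category.assoc, Category.assoc, pullback.lift_fst,
      reassoc_of% h, Category.comp_id]
  · rw [Category.assoc, pullback.diagonal_snd, Category.assoc, Category.assoc, pullback.lift_snd,
      Category.comp_id]

/-- A lifting structure of a map between fibrant objects makes it the section of a homotopy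
retraction. -/
def homotopyRetraction : HomotopyRetraction I s hE.point where
  r := F.retraction hY
  h := I.idLift (F.homotopy_w hY hE) (F.fill (F.homotopy_aux I hY hE)) (F.fill_comp _)
  comp_r := F.comp_retraction hY
  h_src := I.idLift_src _ _ _
  h_tgt := I.idLift_tgt _ _ _
  comp_h := by
    have h : s.left ≫ (F.retraction hY).left = 𝟙 _ :=
      congrArg CommaMorphism.left (F.comp_retraction hY)
    apply PreIdStructure.id_hom_ext
    · rw [Category.assoc, I.idLift_src, Category.assoc, Category.assoc, I.refl_src,
        reassoc_of% h]
      exact congrArg _ (Category.comp_id _).symm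
    · rw [Category.assoc, I.idLift_tgt, Category.assoc, Category.assoc, I.refl_tgt]
      exact congrArg _ (Category.comp_id _).symm
    · rw [Category.assoc, I.idLift_point, comp_fill, Category.assoc, Category.assoc,
        I.refl_point]

theorem homotopyRetraction_h_idPoint :
    (F.homotopyRetraction I hY hE).h ≫ I.idPoint = F.fill (F.homotopy_aux I hY hE) :=
  I.idLift_point (F.homotopy_w hY hE) _ (F.fill_comp _)

/-- Both the retraction and the underlying element of the homotopy are fillers, and `fill_reindex`
compares fillers. The retraction comes first because it enters the lifting problem for the homotopy.
-/
theorem homotopyRetraction_isBaseChange {B' : C} {g : B' ⟶ B} {Y' E' : Over B'} {s' : Y' ⟶ E'}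
    {cY : Y'.left ⟶ Y.left} {cE : E'.left ⟶ E.left}
    (hcY : IsPullback cY Y'.hom Y.hom g) (hcE : IsPullback cE E'.hom E.hom g)
    (hs : s'.left ≫ cE = cY ≫ s.left) :
    ((F.reindex s' hcY hcE hs).homotopyRetraction I (hY.pullback hcY)
      (hE.pullback hcE)).IsBaseChange (F.homotopyRetraction I hY hE) cY cE := by
  have hr : ((F.reindex s' hcY hcE hs).retraction (hY.pullback hcY)).left ≫ cY =
      cE ≫ (F.retraction hY).left := by
    apply hY.isPullback.hom_ext
    · have h : _ ≫ cY ≫ hY.point = _ :=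
        (F.reindex s' hcY hcE hs).retraction_point (hY.pullback hcY)
      rw [Category.assoc, h, Category.assoc, retraction_point,
        ← F.fill_reindex hcY hcE hs (retraction_aux hY) (by
          rw [Category.assoc, retraction_aux hY, ← Category.assoc, ← hs, Category.assoc])]
      refine fill_congr _ _ _ rfl ?_
      rw [FibrancyStructure.pullback_name, ← Category.assoc, ← hcE.w, Category.assoc]
    · rw [Category.assoc, hcY.w, Category.assoc, Over.w, ← Category.assoc, Over.w, hcE.w]
  refine HomotopyRetraction.isBaseChange_of_idPoint hs rfl hr ?_
  rw [homotopyRetraction_h_idPoint, homotopyRetraction_h_idPoint]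
  rw [← F.fill_reindex hcY hcE hs (F.homotopy_aux I hY hE) (by
    rw [Category.assoc, F.homotopy_aux I hY hE, ← Category.assoc, ← hs, Category.assoc])]
  refine fill_congr _ _ _ ?_ ?_
  · rw [FibrancyStructure.pullback_point, Category.assoc, reassoc_of% hs]
  · rw [← Category.assoc cE]
    congr 1
    apply pullback.hom_ext
    · rw [pullback.lift_fst, Category.assoc, pullback.lift_fst,
        FibrancyStructure.pullback_point, reassoc_of% hs, reassoc_of% hr]
    · rw [pullback.lift_snd, Category.assoc, pullback.lift_snd,
        FibrancyStructure.pullback_point]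

end LiftingStructure

end Retract

/-! ### Lifting structures from homotopy retractions -/

namespace HomotopyRetraction

section Lift

variable {Ut U : C} {π : Ut ⟶ U} [ChosenPullbacksAlong π] {I : IdStructure π}
  {B : C} {Y E : Over B} {s : Y ⟶ E} {hE : FibrancyStructure π E.hom}
  (D : HomotopyRetraction I.toPreIdStructure s hE.point) (X : Over B)

variable (hE) in
/-- `X` as an object over `U`, by means of the name of `E`. -/
abbrev nameOver : Over U := Over.mk (X.hom ≫ hE.name)

variable (hE) in
/-- The canonical isomorphism `X ×_U Ut ⟶ X ×_B E`. -/
def fiberMap : pullback (nameOver hE X).hom (Over.mk π).hom ⟶ pullback X.hom E.hom :=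
  pullback.lift (pullback.fst _ _)
    (hE.isPullback.lift (pullback.snd (nameOver hE X).hom (Over.mk π).hom)
      (pullback.fst (nameOver hE X).hom (Over.mk π).hom ≫ X.hom) (by
        rw [Category.assoc]; exact pullback.condition.symm))
    (by rw [IsPullback.lift_snd])

variable (hE) in
theorem fiberMap_fst : fiberMap hE X ≫ pullback.fst X.hom E.hom =
    pullback.fst (nameOver hE X).hom (Over.mk π).hom := pullback.lift_fst _ _ _

variable (hE) in
theorem fiberMap_snd : fiberMap hE X ≫ pullback.snd X.hom E.hom ≫ hE.point =
    pullback.snd (nameOver hE X).hom (Over.mk π).hom := by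
  rw [fiberMap, pullback.lift_snd_assoc, IsPullback.lift_fst]

theorem fiber_hom_ext (hE : FibrancyStructure π E.hom) {X : Over B} {W : C}
    {a b : W ⟶ pullback X.hom E.hom}
    (h₁ : a ≫ pullback.fst X.hom E.hom = b ≫ pullback.fst X.hom E.hom)
    (h₂ : a ≫ pullback.snd X.hom E.hom ≫ hE.point = b ≫ pullback.snd X.hom E.hom ≫ hE.point) :
    a = b := by
  apply pullback.hom_ext h₁
  apply hE.isPullback.hom_ext
  · simpa using h₂
  · rw [Category.assoc, Category.assoc, ← pullback.condition, reassoc_of% h₁]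

theorem h_hom : D.h ≫ I.idOver.hom = E.hom ≫ hE.name := by
  rw [← I.src_comp, ← Category.assoc, D.h_src, Category.assoc, Category.assoc, hE.isPullback.w,
    ← Category.assoc s.left, Over.w, ← Category.assoc, Over.w]

/-- The homotopy as a map `X ×_B E ⟶ X ×_U Id_U(Ut)`. -/
def path : pullback X.hom E.hom ⟶ pullback (nameOver hE X).hom I.idOver.hom :=
  pullback.lift (pullback.fst _ _) (pullback.snd _ _ ≫ D.h)
    (by rw [Category.assoc, h_hom, ← Category.assoc, ← pullback.condition, Category.assoc]; rfl)

theorem path_fst : D.path X ≫ pullback.fst _ _ = pullback.fst X.hom E.hom :=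
  pullback.lift_fst _ _ _

theorem path_snd : D.path X ≫ pullback.snd _ _ = pullback.snd X.hom E.hom ≫ D.h :=
  pullback.lift_snd _ _ _

/-- With `path_tgtMap`, this places the homotopy between `r ≫ s` and the identity after identifying
`X ×_U Ut` with `X ×_B E`, so that `v` becomes a family to which transport applies. -/
theorem path_srcMap : D.path X ≫ I.srcMap (nameOver hE X) ≫ fiberMap hE X =
    baseMap X D.r ≫ baseMap X s := by
  apply fiber_hom_ext hE
  · rw [Category.assoc, Category.assoc, fiberMap_fst, I.srcMap_fst, path_fst, Category.assoc,
      baseMap_fst, baseMap_fst]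
  · rw [Category.assoc, Category.assoc, fiberMap_snd, I.srcMap_snd, ← Category.assoc, path_snd,
      Category.assoc, D.h_src, Category.assoc, ← Category.assoc (baseMap X s), baseMap_snd,
      Category.assoc, ← Category.assoc (baseMap X D.r), baseMap_snd, Category.assoc]

theorem path_tgtMap : D.path X ≫ I.tgtMap (nameOver hE X) ≫ fiberMap hE X = 𝟙 _ := by
  apply fiber_hom_ext hE
  · rw [Category.assoc, Category.assoc, fiberMap_fst, I.tgtMap_fst, path_fst, Category.id_comp]
  · rw [Category.assoc, Category.assoc, fiberMap_snd, I.tgtMap_snd, ← Category.assoc, path_snd,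
      Category.assoc, D.h_tgt, Category.id_comp]

/-- The map `X ×_B Y ⟶ X ×_U Ut`. -/
def basePoint : pullback X.hom Y.hom ⟶ pullback (nameOver hE X).hom (Over.mk π).hom :=
  baseMap X s ≫ D.path X ≫ I.srcMap (nameOver hE X)

/-- Constancy of the homotopy on `s`: over `X ×_B Y` the path is reflexivity, hence transport along
it is trivial. -/
theorem baseMap_path :
    baseMap X s ≫ D.path X = D.basePoint X ≫ baseMap (nameOver hE X) I.refl := by
  apply pullback.hom_ext
  · rw [Category.assoc, Category.assoc, baseMap_fst, basePoint, Category.assoc, Category.assoc,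
      I.srcMap_fst]
  · have h : s.left ≫ D.r.left = 𝟙 _ := congrArg CommaMorphism.left D.comp_r
    rw [Category.assoc, Category.assoc, baseMap_snd, basePoint, Category.assoc, Category.assoc,
      ← Category.assoc (I.srcMap _), I.srcMap_snd, path_snd, Category.assoc,
      ← Category.assoc (D.path X), path_snd, Category.assoc, ← Category.assoc D.h, D.h_src,
      ← Category.assoc, ← Category.assoc, baseMap_snd, Category.assoc, Category.assoc, D.comp_h,
      Category.assoc, Category.assoc, reassoc_of% h]

theorem baseMap_r : baseMap X s ≫ baseMap X D.r = 𝟙 _ := by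
  have h : s.left ≫ D.r.left = 𝟙 _ := congrArg CommaMorphism.left D.comp_r
  apply pullback.hom_ext
  · rw [Category.assoc, baseMap_fst, baseMap_fst, Category.id_comp]
  · rw [Category.assoc, baseMap_snd, ← Category.assoc, baseMap_snd, Category.assoc, h,
      Category.id_comp]
    exact Category.comp_id _

variable [ExponentiableMorphism π] (P : PiStructure π)

section

variable {X : Over B} {u : pullback X.hom Y.hom ⟶ Ut} {v : pullback X.hom E.hom ⟶ U}

/-- The element `u` at the retract has the type `v` prescribes at the source of the path, so it can
be transported. -/
theorem lift_aux (w : u ≫ π = baseMap X s ≫ v) : (baseMap X D.r ≫ u) ≫ π =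
    D.path X ≫ I.srcMap (nameOver hE X) ≫ fiberMap hE X ≫ v := by
  rw [Category.assoc, w, ← Category.assoc, ← D.path_srcMap, Category.assoc, Category.assoc]

/-- The solution of a lifting problem of `X ×_B s` given by transport along the homotopy. -/
def lift (w : u ≫ π = baseMap X s ≫ v) : pullback X.hom E.hom ⟶ Ut :=
  I.transport P (D.lift_aux w)

theorem comp_lift (w : u ≫ π = baseMap X s ≫ v) : baseMap X s ≫ D.lift P w = u := by
  rw [lift, I.comp_transport P (D.lift_aux w) _ (by
    rw [Category.assoc, D.lift_aux w, Category.assoc]),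
    I.transport_refl P _ (D.baseMap_path X), ← Category.assoc, baseMap_r, Category.id_comp]

theorem lift_comp (w : u ≫ π = baseMap X s ≫ v) : D.lift P w ≫ π = v := by
  rw [lift, I.transport_comp, ← Category.assoc (I.tgtMap _), ← Category.assoc, path_tgtMap,
    Category.id_comp]

variable {D} in
-- One naturality statement covering both changes of test object over a fixed base (`g` an identity)
-- and reindexing along `g` (`t` an identity). This is why the comparison maps `mY` and `mE` are
-- left arbitrary.
theorem IsBaseChange.comp_lift {B' : C} {g : B' ⟶ B} {Y' E' : Over B'} {s' : Y' ⟶ E'}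
    {hE' : FibrancyStructure π E'.hom} {D' : HomotopyRetraction I.toPreIdStructure s' hE'.point}
    {cY : Y'.left ⟶ Y.left} {cE : E'.left ⟶ E.left} (hD : D'.IsBaseChange D cY cE)
    (hname : hE'.name = g ≫ hE.name) (hpoint : hE'.point = cE ≫ hE.point)
    {X' : Over B'} {t : X'.left ⟶ X.left} (ht : t ≫ X.hom = X'.hom ≫ g)
    {mY : pullback X'.hom Y'.hom ⟶ pullback X.hom Y.hom}
    {mE : pullback X'.hom E'.hom ⟶ pullback X.hom E.hom}
    (hY₁ : mY ≫ pullback.fst _ _ = pullback.fst _ _ ≫ t)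
    (hY₂ : mY ≫ pullback.snd _ _ = pullback.snd _ _ ≫ cY)
    (hE₁ : mE ≫ pullback.fst _ _ = pullback.fst _ _ ≫ t)
    (hE₂ : mE ≫ pullback.snd _ _ = pullback.snd _ _ ≫ cE)
    (w : u ≫ π = baseMap X s ≫ v) {u' : pullback X'.hom Y'.hom ⟶ Ut}
    {v' : pullback X'.hom E'.hom ⟶ U} (w' : u' ≫ π = baseMap X' s' ≫ v')
    (hu : u' = mY ≫ u) (hv : v' = mE ≫ v) : D'.lift P w' = mE ≫ D.lift P w := by
  subst hu hv
  let k : nameOver hE' X' ⟶ nameOver hE X := Over.homMk t (by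
    refine (Category.assoc _ _ _).symm.trans ?_
    rw [ht, Category.assoc, ← hname]
    rfl)
  have h₁ : fiberMap hE' X' ≫ mE = testMap k (Over.mk π) ≫ fiberMap hE X := by
    apply fiber_hom_ext hE
    · rw [Category.assoc, hE₁, Category.assoc, fiberMap_fst, testMap_fst, ← Category.assoc,
        fiberMap_fst]
      rfl
    · rw [Category.assoc, ← Category.assoc mE, hE₂, Category.assoc, Category.assoc, fiberMap_snd,
        testMap_snd, ← hpoint, fiberMap_snd]
  have h₂ : mE ≫ D.path X = D'.path X' ≫ testMap k I.idOver := by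
    apply pullback.hom_ext
    · rw [Category.assoc, path_fst, Category.assoc, testMap_fst, hE₁, ← Category.assoc, path_fst]
      rfl
    · rw [Category.assoc, path_snd, Category.assoc, testMap_snd, path_snd, ← Category.assoc, hE₂,
        Category.assoc, hD.h_eq]
  have h₃ : baseMap X' D'.r ≫ mY = mE ≫ baseMap X D.r := by
    apply pullback.hom_ext
    · rw [Category.assoc, hY₁, ← Category.assoc, baseMap_fst, Category.assoc, baseMap_fst, hE₁]
    · rw [Category.assoc, hY₂, ← Category.assoc, baseMap_snd, Category.assoc, Category.assoc,
        baseMap_snd, ← Category.assoc mE, hE₂, Category.assoc, hD.r_comp]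
  -- One element, typed in three ways: over `X'` with the restricted family (`e₁`), by restricting
  -- the element and path over `X` (`e₂`), and with the path of `D'` sent to `X` (`e₃`).
  have e₁ : (baseMap X' D'.r ≫ mY ≫ u) ≫ π = D'.path X' ≫ I.srcMap (nameOver hE' X') ≫
      testMap k (Over.mk π) ≫ fiberMap hE X ≫ v := by
    rw [D'.lift_aux w', reassoc_of% h₁]
  have e₂ : (mE ≫ baseMap X D.r ≫ u) ≫ π = (mE ≫ D.path X) ≫ I.srcMap (nameOver hE X) ≫
      fiberMap hE X ≫ v := by
    rw [Category.assoc, D.lift_aux w, Category.assoc]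
  have e₃ : (baseMap X' D'.r ≫ mY ≫ u) ≫ π = (D'.path X' ≫ testMap k I.idOver) ≫
      I.srcMap (nameOver hE X) ≫ fiberMap hE X ≫ v := by
    rw [← h₂, ← e₂, reassoc_of% h₃]
  rw [lift, lift, I.comp_transport P _ mE e₂,
    I.transport_congr P (D'.lift_aux w') e₁ rfl rfl (by rw [reassoc_of% h₁]),
    I.transport_testMap P k e₁ e₃]
  exact I.transport_congr P _ _ h₂.symm (by rw [reassoc_of% h₃]) rfl

end

theorem isBaseChange_id : D.IsBaseChange D (𝟙 _) (𝟙 _) :=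
  ⟨(Category.comp_id _).trans (Category.id_comp _).symm, (Category.id_comp _).symm⟩

/-- A homotopy retraction of a map into a fibrant object induces a lifting structure. -/
def liftingStructure : LiftingStructure π s where
  lift _ _ _ w := D.lift P w
  upper _ _ _ w := D.comp_lift P w
  lower _ _ _ w := D.lift_comp P w
  -- Uniformity is naturality with the base held fixed.
  uniform t _ _ w := D.isBaseChange_id.comp_lift P (g := 𝟙 B)
    (Category.id_comp _).symm (Category.id_comp _).symm
    ((Over.w t).trans (Category.comp_id _).symm) (testMap_fst t Y)
    ((testMap_snd t Y).trans (Category.comp_id _).symm) (testMap_fst t E)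
    ((testMap_snd t E).trans (Category.comp_id _).symm) w _ rfl rfl

variable {D} in
theorem IsBaseChange.liftingStructure_eq {B' : C} {g : B' ⟶ B} {Y' E' : Over B'} {s' : Y' ⟶ E'}
    {hE' : FibrancyStructure π E'.hom} {D' : HomotopyRetraction I.toPreIdStructure s' hE'.point}
    {cY : Y'.left ⟶ Y.left} {cE : E'.left ⟶ E.left} (hD : D'.IsBaseChange D cY cE)
    (hname : hE'.name = g ≫ hE.name) (hpoint : hE'.point = cE ≫ hE.point)
    (hcY : IsPullback cY Y'.hom Y.hom g) (hcE : IsPullback cE E'.hom E.hom g)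
    (hs : s'.left ≫ cE = cY ≫ s.left) :
    D'.liftingStructure P = (D.liftingStructure P).reindex s' hcY hcE hs := by
  ext X u v w
  exact hD.comp_lift P (X := (Over.map g).obj X) (t := 𝟙 _) hname hpoint (Category.id_comp _)
    ((pasteHom_fst hcY X).trans (Category.comp_id _).symm) (pasteHom_snd hcY X)
    ((pasteHom_fst hcE X).trans (Category.comp_id _).symm) (pasteHom_snd hcE X)
    (by rw [Category.assoc, w, pasteInv_baseMap_assoc hcY X hcE hs]) w
    (pasteHom_pasteInv_assoc hcY X u).symm (pasteHom_pasteInv_assoc hcE X v).symm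

end Lift

end HomotopyRetraction

/-! ### Pushforward of homotopy retractions -/

section Pushforward

variable {Ut U : C} {π : Ut ⟶ U} [ChosenPullbacksAlong π] [ExponentiableMorphism π]
  {A B : C} {q : B ⟶ A} (hq : FibrancyStructure π q)

/-- The evaluation `B ×_A q_* E ⟶ E`. -/
def pushforwardEval (E : Over B) :
    pullback ((pushforward q hq.isFibration).obj E).hom q ⟶ E.left :=
  ((pushforwardAdj q hq.isFibration).counit.app E).left

theorem pushforwardEval_comp (E : Over B) :
    pushforwardEval hq E ≫ E.hom = pullback.snd _ q :=
  Over.w ((pushforwardAdj q hq.isFibration).counit.app E)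

/-- Pasting with the fibrancy square of `q` makes maps out of `B ×_A T` classifiable by `P_π`. -/
theorem isPullback_baseChange (T : Over A) :
    IsPullback (pullback.snd T.hom q ≫ hq.point) (pullback.fst T.hom q) π (T.hom ≫ hq.name) :=
  ((IsPullback.of_hasPullback T.hom q).paste_vert hq.isPullback.flip).flip

/-- The map `q_* E ⟶ P_π(Z)` induced by a map `E ⟶ Z`. -/
def pushforwardCurry {E : Over B} {Z : C} (f : E.left ⟶ Z) :
    ((pushforward q hq.isFibration).obj E).left ⟶ polyObj π Z :=
  curry (isPullback_baseChange hq ((pushforward q hq.isFibration).obj E))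
    (pushforwardEval hq E ≫ f)

/-- Transposition for `q_*` and classification by `P_π` agree: a map into `q_* E` followed by
`pushforwardCurry` names its transpose followed by `f`. -/
theorem comp_pushforwardCurry {T : Over A} {E : Over B} {Z : C} (f : E.left ⟶ Z)
    (k : T ⟶ (pushforward q hq.isFibration).obj E) :
    k.left ≫ pushforwardCurry hq f = curry (isPullback_baseChange hq T)
      ((((pushforwardAdj q hq.isFibration).homEquiv _ _).symm k).left ≫ f) := by
  have hk : (((pushforwardAdj q hq.isFibration).homEquiv _ _).symm k).left =
      ((Over.pullback q).map k).left ≫ pushforwardEval hq E := by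
    rw [Adjunction.homEquiv_counit]; rfl
  have h₁ : ((Over.pullback q).map k).left ≫
      pullback.fst ((pushforward q hq.isFibration).obj E).hom q = pullback.fst T.hom q ≫ k.left :=
    pullback.lift_fst _ _ _
  have h₂ : ((Over.pullback q).map k).left ≫
      pullback.snd ((pushforward q hq.isFibration).obj E).hom q = pullback.snd T.hom q :=
    pullback.lift_snd _ _ _
  rw [hk, pushforwardCurry, comp_curry _ (isPullback_baseChange hq T)
    (δ := ((Over.pullback q).map k).left) (by rw [reassoc_of% h₂]) h₁
    (by rw [← Category.assoc, Over.w])]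
  exact congrArg _ (Category.assoc _ _ _).symm

theorem map_pushforwardCurry {E E' : Over B} {Z : C} (k : E ⟶ E') (f : E'.left ⟶ Z) :
    ((pushforward q hq.isFibration).map k).left ≫ pushforwardCurry hq f =
      pushforwardCurry hq (k.left ≫ f) := by
  have hk : ((pushforwardAdj q hq.isFibration).homEquiv _ _).symm
      ((pushforward q hq.isFibration).map k) =
        (pushforwardAdj q hq.isFibration).counit.app E ≫ k :=
    (Adjunction.homEquiv_counit _ _ _ _).trans (Adjunction.counit_naturality _ _)
  rw [comp_pushforwardCurry, hk, pushforwardCurry]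
  exact congrArg _ (Category.assoc _ _ _)

theorem pushforwardCurry_map {E : Over B} {Z Z' : C} (f : E.left ⟶ Z) (z : Z ⟶ Z') :
    pushforwardCurry hq f ≫ polyMap π z = pushforwardCurry hq (f ≫ z) := by
  rw [pushforwardCurry, curry_map, Category.assoc, pushforwardCurry]

theorem pushforwardCurry_const {E : Over B} {Z : C} (b : B ⟶ Z) :
    pushforwardCurry hq (E.hom ≫ b) =
      ((pushforward q hq.isFibration).obj E).hom ≫ curry hq.isPullback b := by
  rw [pushforwardCurry, comp_curry hq.isPullback
    (isPullback_baseChange hq ((pushforward q hq.isFibration).obj E))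
    (δ := pullback.snd _ q) rfl pullback.condition.symm rfl, ← Category.assoc,
    pushforwardEval_comp]

/-- A cone with vertex `T` names a map `B ×_A T ⟶ Ut` lying over the name of `E`. By fibrancy of `E`
this is a map to `E` over `B`, that is, a map `T ⟶ q_* E` over `A`. -/
theorem isPullback_pushforwardCurry {E : Over B} (hE : FibrancyStructure π E.hom) :
    IsPullback (pushforwardCurry hq hE.point) ((pushforward q hq.isFibration).obj E).hom
      (polyMap π π) (curry hq.isPullback hE.name) := by
  have w : pushforwardCurry hq hE.point ≫ polyMap π π =
      ((pushforward q hq.isFibration).obj E).hom ≫ curry hq.isPullback hE.name := by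
    rw [pushforwardCurry_map, hE.isPullback.w, pushforwardCurry_const]
  have key : ∀ z : PullbackCone (polyMap π π) (curry hq.isPullback hE.name),
      ∃! l : z.pt ⟶ ((pushforward q hq.isFibration).obj E).left,
        l ≫ pushforwardCurry hq hE.point = z.fst ∧
          l ≫ ((pushforward q hq.isFibration).obj E).hom = z.snd := by
    intro z
    let T : Over A := Over.mk z.snd
    let sq := isPullback_baseChange hq T
    have hz : z.fst ≫ polyName π Ut = z.snd ≫ hq.name := by
      rw [← polyMap_name π π, ← Category.assoc, z.condition, Category.assoc, curry_name]
    have hz' : (z.fst ≫ polyMap π π) ≫ polyName π U = z.snd ≫ hq.name := by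
      rw [Category.assoc, polyMap_name, hz]
    have hu : uncurry sq z.fst hz ≫ π = pullback.snd T.hom q ≫ hE.name := by
      rw [← uncurry_map sq z.fst hz π hz']
      simp only [z.condition]
      exact (uncurry_comp hq.isPullback sq (δ := pullback.snd T.hom q) rfl
        pullback.condition.symm _ (curry_name _ _) _).trans (congrArg _ (uncurry_curry _ _))
    let m : (Over.pullback q).obj T ⟶ E :=
      Over.homMk (hE.isPullback.lift _ _ hu) (IsPullback.lift_snd _ _ _ _)
    have hm : m.left ≫ hE.point = uncurry sq z.fst hz := IsPullback.lift_fst _ _ _ _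
    let e := (pushforwardAdj q hq.isFibration).homEquiv T E
    refine ⟨(e m).left, ⟨?_, Over.w (e m)⟩, ?_⟩
    · rw [comp_pushforwardCurry, Equiv.symm_apply_apply, hm, curry_uncurry]
    · rintro l ⟨h₁, h₂⟩
      let k : T ⟶ (pushforward q hq.isFibration).obj E := Over.homMk l h₂
      have h₃ : curry sq ((e.symm k).left ≫ hE.point) = z.fst :=
        (comp_pushforwardCurry hq hE.point k).symm.trans h₁
      have h₄ : (e.symm k).left ≫ hE.point = m.left ≫ hE.point := by
        rw [hm, ← uncurry_curry sq ((e.symm k).left ≫ hE.point)]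
        simp only [h₃]
      have h₅ : e.symm k = m := by
        ext
        exact hE.isPullback.hom_ext h₄ ((Over.w (e.symm k)).trans (Over.w m).symm)
      exact congrArg CommaMorphism.left ((Equiv.symm_apply_eq e).1 h₅)
  exact ⟨⟨w⟩, ⟨PullbackCone.IsLimit.mk _ (fun z => (key z).choose)
    (fun z => (key z).choose_spec.1.1) (fun z => (key z).choose_spec.1.2)
    (fun z m h₁ h₂ => (key z).choose_spec.2 m ⟨h₁, h₂⟩)⟩⟩

variable (P : PiStructure π)

/-- The pushforward of a fibrant object along a fibration is fibrant. -/
def pushforwardFibrancy {E : Over B} (hE : FibrancyStructure π E.hom) :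
    FibrancyStructure π ((pushforward q hq.isFibration).obj E).hom where
  name := curry hq.isPullback hE.name ≫ piName P
  point := pushforwardCurry hq hE.point ≫ piPoint P
  isPullback := (isPullback_pushforwardCurry hq hE).paste_horiz (isPullback_pi P)

/-! ### Strict stability of the fibrancy structure on `q_* E` -/

section BaseChange

variable {A' B' : C} {q' : B' ⟶ A'} {f : A' ⟶ A} {g : B' ⟶ B} (sq : IsPullback g q' q f)
  {E : Over B} {E' : Over B'} {c : E'.left ⟶ E.left} (hc : IsPullback c E'.hom E.hom g)

/-- The Beck-Chevalley map is itself a transpose of evaluation followed by `c`, so both sides name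
the same map out of isomorphic pullbacks. -/
theorem beckChevalley_pushforwardCurry {Z : C} (k : E.left ⟶ Z) :
    beckChevalley sq hq.isFibration (hq.pullback sq).isFibration hc ≫ pushforwardCurry hq k =
      pushforwardCurry (hq.pullback sq) (c ≫ k) := by
  let hq' := (hq.pullback sq).isFibration
  let T := (Over.map f).obj ((pushforward q' hq').obj E')
  let a : (Over.pullback q).obj T ⟶ E :=
    transposeAux sq hc _ ((pushforwardAdj q' hq').counit.app E')
  have ha : pasteHom (Y := Over.mk q) (Y' := Over.mk q') sq ((pushforward q' hq').obj E') ≫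
      a.left = pushforwardEval (hq.pullback sq) E' ≫ c :=
    pasteHom_pasteInv_assoc (Y := Over.mk q) (Y' := Over.mk q') sq _ _
  refine (comp_pushforwardCurry hq k
    ((pushforwardAdj q hq.isFibration).homEquiv T E a)).trans ?_
  rw [Equiv.symm_apply_apply]
  have h := comp_curry (isPullback_baseChange hq T)
    (isPullback_baseChange (hq.pullback sq) ((pushforward q' hq').obj E'))
    -- The context does not change; only the pullback of `π` over it does, from `B ×_A -` to `B'
    -- ×_{A'} -`.
    (γ := 𝟙 _)
    (δ := pasteHom (Y := Over.mk q) (Y' := Over.mk q') sq ((pushforward q' hq').obj E'))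
    (by
      refine (Category.assoc _ _ _).symm.trans
        ((congrArg (· ≫ hq.point) (pasteHom_snd (Y := Over.mk q) (Y' := Over.mk q') sq
          ((pushforward q' hq').obj E'))).trans ?_)
      exact Category.assoc _ _ _)
    ((pasteHom_fst (Y := Over.mk q) (Y' := Over.mk q') sq _).trans (Category.comp_id _).symm)
    ((Category.id_comp _).trans (Category.assoc _ _ _)) (a.left ≫ k)
  refine (Category.id_comp _).symm.trans (h.trans ?_)
  rw [pushforwardCurry, ← Category.assoc, ha, Category.assoc]

theorem pushforward_pullback_name (hE : FibrancyStructure π E.hom) :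
    (pushforwardFibrancy (hq.pullback sq) P (hE.pullback hc)).name =
      f ≫ (pushforwardFibrancy hq P hE).name := by
  refine Eq.trans ?_ (Category.assoc _ _ _)
  refine congrArg (· ≫ piName P) (Eq.symm ?_)
  exact comp_curry hq.isPullback (hq.pullback sq).isPullback rfl sq.w rfl hE.name

theorem pushforward_pullback_point (hE : FibrancyStructure π E.hom) :
    (pushforwardFibrancy (hq.pullback sq) P (hE.pullback hc)).point =
      beckChevalley sq hq.isFibration (hq.pullback sq).isFibration hc ≫
        (pushforwardFibrancy hq P hE).point := by
  refine Eq.trans ?_ (Category.assoc _ _ _)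
  exact congrArg (· ≫ piPoint P) (beckChevalley_pushforwardCurry hq sq hc hE.point).symm

end BaseChange

/-! #### Functional extensionality -/

namespace IdStructure

variable {P} {I : IdStructure π} (F : PtdFunExt I)

variable (P I) in
theorem funExt_w : (polyMap π I.src ≫ piPoint P) ≫ π = (polyMap π I.tgt ≫ piPoint P) ≫ π := by
  rw [Category.assoc, Category.assoc, (isPullback_pi P).w, ← Category.assoc, ← Category.assoc,
    ← polyMap_comp, ← polyMap_comp, I.src_comp, I.tgt_comp]

theorem polyMap_refl_comp {f : I.idOver.left ⟶ Ut} (hf : I.refl.left ≫ f = 𝟙 Ut) :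
    polyMap π I.refl.left ≫ polyMap π f = 𝟙 _ :=
  (polyMap_comp π _ _).symm.trans ((congrArg (polyMap π) hf).trans (polyMap_id π Ut))

variable (P I) in
-- `P_π` of the source and target maps both retract `P_π(refl)`, so on constant families of
-- reflexivities the required identification has equal end points and reflexivity provides it.
theorem funExt_aux : (piPoint P ≫ I.reflPoint) ≫ π =
    polyMap π I.refl.left ≫ pullback.lift _ _ (funExt_w P I) ≫ I.Id := by
  rw [Category.assoc, I.comm, ← Category.assoc, ← Category.assoc]
  congr 1
  apply pullback.hom_ext
  · rw [Category.assoc, pullback.diagonal_fst, Category.assoc, pullback.lift_fst,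
      ← Category.assoc (polyMap π I.refl.left), polyMap_refl_comp I.refl_src, Category.id_comp,
      Category.comp_id]
  · rw [Category.assoc, pullback.diagonal_snd, Category.assoc, pullback.lift_snd,
      ← Category.assoc (polyMap π I.refl.left), polyMap_refl_comp I.refl_tgt, Category.id_comp,
      Category.comp_id]

variable (P) in
/-- Functional extensionality: the map `P_π(Id_U(Ut)) ⟶ Id_U(Ut)` which takes a family of
identifications to an identification of functions. -/
def funExt : polyObj π I.idOver.left ⟶ I.idOver.left :=
  I.idLift (funExt_w P I) (F.fill (funExt_aux P I)) (F.fill_comp _)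

theorem funExt_src : funExt P F ≫ I.src = polyMap π I.src ≫ piPoint P := I.idLift_src _ _ _

theorem funExt_tgt : funExt P F ≫ I.tgt = polyMap π I.tgt ≫ piPoint P := I.idLift_tgt _ _ _

/-- Pointedness: the filler restricts strictly to reflexivity, and the end points agree by the
retractions above. -/
theorem refl_funExt : polyMap π I.refl.left ≫ funExt P F = piPoint P ≫ I.refl.left := by
  apply PreIdStructure.id_hom_ext
  · rw [Category.assoc, funExt_src, ← Category.assoc, polyMap_refl_comp I.refl_src,
      Category.id_comp, Category.assoc, I.refl_src]
    exact (Category.comp_id _).symm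
  · rw [Category.assoc, funExt_tgt, ← Category.assoc, polyMap_refl_comp I.refl_tgt,
      Category.id_comp, Category.assoc, I.refl_tgt]
    exact (Category.comp_id _).symm
  · have h : funExt P F ≫ I.idPoint = F.fill (funExt_aux P I) :=
      I.idLift_point (funExt_w P I) _ (F.fill_comp _)
    rw [Category.assoc, h, Category.assoc, I.refl_point]
    exact F.comp_fill (funExt_aux P I)

end IdStructure

namespace HomotopyRetraction

variable {P} {I : IdStructure π} (F : PtdFunExt I) {Y E : Over B} {s : Y ⟶ E}
  {hE : FibrancyStructure π E.hom} (D : HomotopyRetraction I.toPreIdStructure s hE.point)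

variable (P) in
/-- The pushforward of a homotopy retraction along a fibration. -/
def pushforward : HomotopyRetraction I.toPreIdStructure
    ((UniverseCategory.pushforward q hq.isFibration).map s) (pushforwardFibrancy hq P hE).point where
  r := (UniverseCategory.pushforward q hq.isFibration).map D.r
  h := pushforwardCurry hq D.h ≫ IdStructure.funExt P F
  comp_r := by rw [← Functor.map_comp, D.comp_r, CategoryTheory.Functor.map_id]
  h_src := by
    rw [Category.assoc, IdStructure.funExt_src, ← Category.assoc, pushforwardCurry_map, D.h_src,
      ← map_pushforwardCurry, ← map_pushforwardCurry, Category.assoc, Category.assoc]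
    rfl
  h_tgt := by
    rw [Category.assoc, IdStructure.funExt_tgt, ← Category.assoc, pushforwardCurry_map, D.h_tgt]
    rfl
  comp_h := by
    rw [← Category.assoc, map_pushforwardCurry, D.comp_h, ← map_pushforwardCurry,
      ← pushforwardCurry_map, Category.assoc, Category.assoc, IdStructure.refl_funExt]
    exact congrArg _ (Category.assoc _ _ _).symm

variable {D} in
-- The map `funExt` is fixed once and for all over `U`, so only the classifying map of the homotopy
-- varies, and the Beck-Chevalley map respects it.
theorem IsBaseChange.pushforward {A' B' : C} {q' : B' ⟶ A'} {f : A' ⟶ A} {g : B' ⟶ B}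
    (sq : IsPullback g q' q f) {Y' E' : Over B'} {s' : Y' ⟶ E'} {cY : Y'.left ⟶ Y.left}
    {cE : E'.left ⟶ E.left} {hcY : IsPullback cY Y'.hom Y.hom g}
    {hcE : IsPullback cE E'.hom E.hom g}
    {D' : HomotopyRetraction I.toPreIdStructure s' (hE.pullback hcE).point}
    (hD : D'.IsBaseChange D cY cE) :
    (D'.pushforward (hq.pullback sq) P F).IsBaseChange (D.pushforward hq P F)
      (beckChevalley sq hq.isFibration (hq.pullback sq).isFibration hcY)
      (beckChevalley sq hq.isFibration (hq.pullback sq).isFibration hcE) where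
  -- Naturality is used for the retraction rather than for `s`, so the roles of `Y` and `E` are
  -- exchanged.
  r_comp := beckChevalley_naturality sq hq.isFibration (hq.pullback sq).isFibration hcE hcY
    hD.r_comp
  h_eq := by
    refine Eq.trans ?_ (Category.assoc _ _ _)
    refine congrArg (· ≫ IdStructure.funExt P F) ?_
    rw [beckChevalley_pushforwardCurry, hD.h_eq]

end HomotopyRetraction

/-- The family of maps between lifting structures determined by a pointed functional
extensionality structure. -/
def PushforwardFamily.ofPtdFunExt (P : PiStructure π) {I : IdStructure π} (F : PtdFunExt I) :
    PushforwardFamily π where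
  map _ hq _ _ hY hE _ G :=
    ((G.homotopyRetraction I.toPreIdStructure hY hE).pushforward hq P F).liftingStructure P
  map_reindex _ hq _ _ hY hE _ G _ _ _ _ _ sq _ _ _ _ _ hcY hcE hs :=
    ((G.homotopyRetraction_isBaseChange I.toPreIdStructure hY hE hcY hcE hs).pushforward
      hq F sq).liftingStructure_eq P (pushforward_pullback_name hq P sq hcE hE)
      (pushforward_pullback_point hq P sq hcE hE) _ _ _

end Pushforward

end UniverseCategory

end

theorem mainTheorem4 {C : Type*} [Category* C] [HasFiniteLimits C] {Ut U : C}
    (π : Ut ⟶ U) [ChosenPullbacksAlong π] [ExponentiableMorphism π]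
    (P : PiStructure π) (I : IdStructure π) :
    (∀ _ : PtdFunExt I, Nonempty (PushforwardFamily π)) ∧
    (∀ (σ : FibrancyStructure π I.idOver.hom) (φ : PushforwardFamily π),
      ∃ F : PtdFunExt I, φ.RestrictsTo I σ F) ∧
    (∀ _ : PtdFunExt I, ∀ {A B : C} (q : B ⟶ A) (hq : IsFibration π q) {Y E : Over B},
      IsFibration π Y.hom → IsFibration π E.hom → ∀ s : Y ⟶ E,
        Nonempty (LiftingStructure π s) →
          Nonempty (LiftingStructure π ((pushforward q hq).map s))) :=
  ⟨fun F => ⟨.ofPtdFunExt P F⟩, fun σ φ => ⟨φ.restrict I σ, φ.restrictsTo_restrict I σ⟩,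
    -- Any choice of fibrancy structures serves here, since `pushforward` depends only on the
    -- proposition that `q` is a fibration.
    fun F _ _ q ⟨hq⟩ _ _ ⟨hY⟩ ⟨hE⟩ s ⟨G⟩ => ⟨(PushforwardFamily.ofPtdFunExt P F).map q hq hY hE s G⟩⟩
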